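/- Let $M_0$ be a nonzero additive subgroup of $\mathbb{C}$ with $\mathbb{Z}\cap M_0=\{0\}$, let $M=\mathbb{Z}\oplus M_0\subset\mathbb{C}$, and let $L=\mathrm{Vir}[M]/\mathbb{C}c$ be the centreless generalized Virasoro algebra: the complex Lie algebra with basis $\{d_m : m\in M\}$ and bracket $[d_m,d_n]=(n-m)\,d_{m+n}$. For $i\in\mathbb{Z}$ put $L_i=\bigoplus_{a\in M_0}\mathbb{C}d_{i+a}$, and let $L_+=\bigoplus_{i>0}L_i$. For $\alpha,\beta\in\mathbb{C}$ let $V(\alpha,\beta)=\bigoplus_{b\in M_0}\mathbb{C}v_b$ be the $(L_++L_0)$-module on which $d_av_b=(b+\alpha+a\beta)\,v_{a+b}$ for $a,b\in M_0$ and $L_+V(\alpha,\beta)=0$. Let $\widetilde V=U(L)\otimes_{U(L_++L_0)}V(\alpha,\beta)$ be the induced $L$-module, let $J$ be the largest submodule of $\widetilde V$ that intersects $V(\alpha,\beta)$ trivially, and put $\bar V=\bar V(\alpha,\beta)=\widetilde V/J$. For $\mu\in\mathbb{C}$ let $\bar V_\mu=\{w\in\bar V : d_0w=\mu w\}$. Then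 for all $\alpha,\beta\in\mathbb{C}$, every integer $i\ge 0$ and all $a_1,a_2\in M_0$ with $(-i+\alpha+a_1)(-i+\alpha+a_2)\neq 0$, $$\dim\bar V_{-i+\alpha+a_1}=\dim\bar V_{-i+\alpha+a_2}.$$ -/

import Mathlib

noncomputable section

namespace GenVir

/-- The index group `M = ℤ ⊕ M₀`. When `ℤ ∩ M₀ = 0` the map `val` below is injective and
identifies it with the subgroup `ℤ + M₀` of `ℂ`. -/
abbrev Idx (M₀ : AddSubgroup ℂ) : Type := ℤ × M₀

/-- The complex number `i + a` attached to the index `(i, a)`. -/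
def val {M₀ : AddSubgroup ℂ} (m : Idx M₀) : ℂ := (m.1 : ℂ) + (m.2 : ℂ)

theorem val_add {M₀ : AddSubgroup ℂ} (m n : Idx M₀) : val (m + n) = val m + val n := by
  simp only [val, Prod.fst_add, Prod.snd_add, Int.cast_add, AddSubgroup.coe_add]
  ring

/-- The centreless generalized Virasoro algebra `L = Vir[M] / ℂ c`, as a vector space: it has a
basis of vectors `d m`, for `m` in `M = ℤ ⊕ M₀`. -/
def L (M₀ : AddSubgroup ℂ) : Type := Idx M₀ →₀ ℂ

instance (M₀ : AddSubgroup ℂ) : AddCommGroup (L M₀) :=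
  inferInstanceAs (AddCommGroup (Idx M₀ →₀ ℂ))

instance (M₀ : AddSubgroup ℂ) : Module ℂ (L M₀) :=
  inferInstanceAs (Module ℂ (Idx M₀ →₀ ℂ))

/-- The basis vector `d_m` of `L`. -/
def d {M₀ : AddSubgroup ℂ} (m : Idx M₀) : L M₀ := Finsupp.single m (1 : ℂ)

/-- The linear map on `L` with prescribed values on the basis vectors `d m`. -/
def ext {M₀ : AddSubgroup ℂ} {W : Type*} [AddCommGroup W] [Module ℂ W] (f : Idx M₀ → W) :
    L M₀ →ₗ[ℂ] W :=
  Finsupp.linearCombination ℂ f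

theorem ext_d {M₀ : AddSubgroup ℂ} {W : Type*} [AddCommGroup W] [Module ℂ W] (f : Idx M₀ → W)
    (m : Idx M₀) : ext f (d m) = f m := by
  simp only [ext, d]
  exact (Finsupp.linearCombination_single ℂ (1 : ℂ) m).trans (one_smul ℂ _)

theorem hom_ext {M₀ : AddSubgroup ℂ} {W : Type*} [AddCommGroup W] [Module ℂ W]
    {f g : L M₀ →ₗ[ℂ] W} (h : ∀ m, f (d m) = g (d m)) : f = g :=
  Finsupp.lhom_ext' fun m => LinearMap.ext_ring (h m)

/-- The bracket of `L` as a bilinear map: `[d_m, d_n] = (n - m) d_{m+n}`. -/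
def brk (M₀ : AddSubgroup ℂ) : L M₀ →ₗ[ℂ] L M₀ →ₗ[ℂ] L M₀ :=
  ext fun m => ext fun n => (val n - val m) • d (m + n)

theorem brk_d {M₀ : AddSubgroup ℂ} (m n : Idx M₀) :
    brk M₀ (d m) (d n) = (val n - val m) • d (m + n) := by
  rw [brk, ext_d, ext_d]

theorem brk_skew {M₀ : AddSubgroup ℂ} (x y : L M₀) : brk M₀ x y = -brk M₀ y x := by
  have h : brk M₀ = -(brk M₀).flip := by
    refine hom_ext fun m => hom_ext fun n => ?_
    rw [LinearMap.neg_apply, LinearMap.neg_apply, LinearMap.flip_apply, brk_d, brk_d,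
      add_comm n m, ← neg_smul, neg_sub]
  exact LinearMap.congr_fun (LinearMap.congr_fun h x) y

theorem brk_self {M₀ : AddSubgroup ℂ} (x : L M₀) : brk M₀ x x = 0 := by
  have h := brk_skew x x
  have h2 : (2 : ℂ) • brk M₀ x x = 0 := by
    rw [two_smul]
    nth_rewrite 1 [h]
    exact neg_add_cancel _
  exact (smul_eq_zero.mp h2).resolve_left two_ne_zero

theorem induction_d {M₀ : AddSubgroup ℂ} {p : L M₀ → Prop} (x : L M₀) (h0 : p 0)
    (hadd : ∀ y z, p y → p z → p (y + z)) (hsmul : ∀ (c : ℂ) y, p y → p (c • y))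
    (hd : ∀ m, p (d m)) : p x := by
  refine Finsupp.induction_linear x h0 hadd fun m c => ?_
  have h : (Finsupp.single m c : Idx M₀ →₀ ℂ) = c • Finsupp.single m (1 : ℂ) := by simp
  rw [h]
  exact hsmul c _ (hd m)

theorem brk_leibniz {M₀ : AddSubgroup ℂ} (x y z : L M₀) :
    brk M₀ x (brk M₀ y z) = brk M₀ (brk M₀ x y) z + brk M₀ y (brk M₀ x z) := by
  induction x using induction_d with
  | h0 => simp
  | hadd x x' h h' => simp only [map_add, LinearMap.add_apply, h, h']; abel
  | hsmul c x h => simp only [map_smul, LinearMap.smul_apply, h, smul_add]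
  | hd m =>
  induction y using induction_d with
  | h0 => simp
  | hadd x x' h h' => simp only [map_add, LinearMap.add_apply, h, h']; abel
  | hsmul c x h => simp only [map_smul, LinearMap.smul_apply, h, smul_add]
  | hd n =>
  induction z using induction_d with
  | h0 => simp
  | hadd x x' h h' => simp only [map_add, h, h']; abel
  | hsmul c x h => simp only [map_smul, h, smul_add]
  | hd k =>
  simp only [brk_d, map_smul, LinearMap.smul_apply, smul_smul, val_add]
  rw [add_left_comm n m k, ← add_assoc m n k, ← add_smul]
  congr 1
  ring

instance (M₀ : AddSubgroup ℂ) : LieRing (L M₀) where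
  bracket x y := brk M₀ x y
  add_lie x y z := by simp
  lie_add x y z := by simp
  lie_self x := brk_self x
  leibniz_lie x y z := brk_leibniz x y z

instance (M₀ : AddSubgroup ℂ) : LieAlgebra ℂ (L M₀) where
  lie_smul c x y := map_smul (brk M₀ x) c y

theorem lie_d {M₀ : AddSubgroup ℂ} (m n : Idx M₀) :
    ⁅(d m : L M₀), (d n : L M₀)⁆ = (val n - val m) • d (m + n) := brk_d m n

/-- The subalgebra `L₊ + L₀`, spanned by the `d_{i+a}` with `i ≥ 0` and `a ∈ M₀`. -/
def nonneg (M₀ : AddSubgroup ℂ) : LieSubalgebra ℂ (L M₀) where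
  toSubmodule := Submodule.span ℂ (d '' {m : Idx M₀ | 0 ≤ m.1})
  lie_mem' {x y} hx hy := by
    change x ∈ Submodule.span ℂ (d '' {m : Idx M₀ | 0 ≤ m.1}) at hx
    change y ∈ Submodule.span ℂ (d '' {m : Idx M₀ | 0 ≤ m.1}) at hy
    change ⁅x, y⁆ ∈ Submodule.span ℂ (d '' {m : Idx M₀ | 0 ≤ m.1})
    induction hx, hy using Submodule.span_induction₂ with
    | mem_mem x y hx hy =>
      obtain ⟨m, hm, rfl⟩ := hx
      obtain ⟨n, hn, rfl⟩ := hy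
      rw [lie_d]
      exact Submodule.smul_mem _ _ (Submodule.subset_span ⟨m + n, Int.add_nonneg hm hn, rfl⟩)
    | zero_left y hy => rw [zero_lie]; exact Submodule.zero_mem _
    | zero_right x hx => rw [lie_zero]; exact Submodule.zero_mem _
    | add_left x y z _ _ _ h h' => rw [add_lie]; exact Submodule.add_mem _ h h'
    | add_right x y z _ _ _ h h' => rw [lie_add]; exact Submodule.add_mem _ h h'
    | smul_left r x y _ _ h => rw [smul_lie]; exact Submodule.smul_mem _ _ h
    | smul_right r x y _ _ h => rw [lie_smul]; exact Submodule.smul_mem _ _ h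

attribute [local instance] LieRing.ofAssociativeRing

/-- The underlying space of `V(α, β)`: it has a basis of vectors `v b`, for `b ∈ M₀`. -/
def V (M₀ : AddSubgroup ℂ) : Type := M₀ →₀ ℂ

instance (M₀ : AddSubgroup ℂ) : AddCommGroup (V M₀) :=
  inferInstanceAs (AddCommGroup (M₀ →₀ ℂ))

instance (M₀ : AddSubgroup ℂ) : Module ℂ (V M₀) :=
  inferInstanceAs (Module ℂ (M₀ →₀ ℂ))

/-- The basis vector `v_b` of `V(α, β)`. -/
def v {M₀ : AddSubgroup ℂ} (b : M₀) : V M₀ := Finsupp.single b (1 : ℂ)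

/-- The linear map on `V(α, β)` with prescribed values on the basis vectors `v b`. -/
def extV {M₀ : AddSubgroup ℂ} {W : Type*} [AddCommGroup W] [Module ℂ W] (f : M₀ → W) :
    V M₀ →ₗ[ℂ] W :=
  Finsupp.linearCombination ℂ f

theorem extV_v {M₀ : AddSubgroup ℂ} {W : Type*} [AddCommGroup W] [Module ℂ W] (f : M₀ → W)
    (b : M₀) : extV f (v b) = f b := by
  simp only [extV, v]
  exact (Finsupp.linearCombination_single ℂ (1 : ℂ) b).trans (one_smul ℂ _)

theorem homV_ext {M₀ : AddSubgroup ℂ} {W : Type*} [AddCommGroup W] [Module ℂ W]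
    {f g : V M₀ →ₗ[ℂ] W} (h : ∀ b, f (v b) = g (v b)) : f = g :=
  Finsupp.lhom_ext' fun b => LinearMap.ext_ring (h b)

/-- The operators on `V(α, β)` given by `d_a v_b = (b + α + a β) v_{a+b}` for `a ∈ M₀`, and by
`d_{i+a} v_b = 0` for `i ≠ 0`. Only their restriction to `L₊ + L₀` is used. -/
def act {M₀ : AddSubgroup ℂ} (α β : ℂ) : L M₀ →ₗ[ℂ] Module.End ℂ (V M₀) :=
  ext fun m => if m.1 = 0 then
    extV fun b : M₀ => ((b : ℂ) + α + (m.2 : ℂ) * β) • v (m.2 + b)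
    else 0

theorem act_d {M₀ : AddSubgroup ℂ} (α β : ℂ) (a b : M₀) :
    act α β (d (0, a)) (v b) = ((b : ℂ) + α + (a : ℂ) * β) • v (a + b) := by
  rw [act, ext_d, if_pos rfl, extV_v]

theorem act_d_of_ne {M₀ : AddSubgroup ℂ} (α β : ℂ) (m : Idx M₀) (hm : m.1 ≠ 0) :
    act α β (d m) = 0 := by
  rw [act, ext_d, if_neg hm]

theorem act_lie_d {M₀ : AddSubgroup ℂ} (α β : ℂ) (m n : Idx M₀) (hm : 0 ≤ m.1) (hn : 0 ≤ n.1) :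
    act α β ⁅(d m : L M₀), (d n : L M₀)⁆
      = act α β (d m) * act α β (d n) - act α β (d n) * act α β (d m) := by
  obtain ⟨i, a⟩ := m
  obtain ⟨j, b⟩ := n
  simp only at hm hn
  rw [lie_d, map_smul]
  by_cases hi : i = 0
  · by_cases hj : j = 0
    · subst hi hj
      refine homV_ext fun k => ?_
      simp only [LinearMap.smul_apply, LinearMap.sub_apply, Module.End.mul_apply,
        Prod.mk_add_mk, add_zero, act_d, map_smul, smul_smul]
      rw [add_left_comm b a k, ← add_assoc a b k, ← sub_smul]
      congr 1
      simp only [val, AddSubgroup.coe_add, Int.cast_zero]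
      ring
    · rw [act_d_of_ne α β (j, b) hj, act_d_of_ne α β _ (by simp only [Prod.fst_add]; omega)]
      simp
  · rw [act_d_of_ne α β (i, a) hi, act_d_of_ne α β _ (by simp only [Prod.fst_add]; omega)]
    simp

theorem act_lie {M₀ : AddSubgroup ℂ} (α β : ℂ) {x y : L M₀} (hx : x ∈ nonneg M₀)
    (hy : y ∈ nonneg M₀) :
    act α β ⁅x, y⁆ = act α β x * act α β y - act α β y * act α β x := by
  change x ∈ Submodule.span ℂ (d '' {m : Idx M₀ | 0 ≤ m.1}) at hx
  change y ∈ Submodule.span ℂ (d '' {m : Idx M₀ | 0 ≤ m.1}) at hy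
  induction hx, hy using Submodule.span_induction₂ with
  | mem_mem x y hx hy =>
    obtain ⟨m, hm, rfl⟩ := hx
    obtain ⟨n, hn, rfl⟩ := hy
    exact act_lie_d α β m n hm hn
  | zero_left y hy => simp
  | zero_right x hx => simp
  | add_left x y z _ _ _ h h' => simp only [add_lie, map_add, h, h', add_mul, mul_add]; abel
  | add_right x y z _ _ _ h h' => simp only [lie_add, map_add, h, h', add_mul, mul_add]; abel
  | smul_left r x y _ _ h =>
    simp only [smul_lie, map_smul, h, smul_mul_assoc, mul_smul_comm, smul_sub]
  | smul_right r x y _ _ h =>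
    simp only [lie_smul, map_smul, h, smul_mul_assoc, mul_smul_comm, smul_sub]

/-- The module `V(α, β)` over `L₊ + L₀`: `L₀` acts by `d_a v_b = (b + α + a β) v_{a+b}` and `L₊`
acts by zero. -/
def rho (M₀ : AddSubgroup ℂ) (α β : ℂ) : nonneg M₀ →ₗ⁅ℂ⁆ Module.End ℂ (V M₀) where
  toLinearMap := (act α β).comp (nonneg M₀).toSubmodule.subtype
  map_lie' {x y} := act_lie α β x.2 y.2

/-- The universal enveloping algebra of `L`. A left `U`-module is the same as an `L`-module. -/
abbrev U (M₀ : AddSubgroup ℂ) : Type := UniversalEnvelopingAlgebra ℂ (L M₀)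

open scoped TensorProduct

/-- The left `U(L)`-submodule of `U(L) ⊗_ℂ V(α, β)` that has to be divided out to get the tensor
product over `U(L₊ + L₀)`. Since `L₊ + L₀` generates its enveloping algebra and the submodule is
stable under left multiplication, the relations `x ⊗ v = 1 ⊗ x v` with `x ∈ L₊ + L₀` give all
relations `u w ⊗ v = u ⊗ w v` with `w ∈ U(L₊ + L₀)`. -/
def indRel (M₀ : AddSubgroup ℂ) (α β : ℂ) : Submodule (U M₀) (U M₀ ⊗[ℂ] V M₀) :=
  Submodule.span (U M₀)
    {t | ∃ (x : nonneg M₀) (v : V M₀),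
      t = UniversalEnvelopingAlgebra.ι ℂ (x : L M₀) ⊗ₜ[ℂ] v - 1 ⊗ₜ[ℂ] rho M₀ α β x v}

/-- The induced module `Ṽ(α, β) = U(L) ⊗_{U(L₊ + L₀)} V(α, β)`. -/
abbrev Vtilde (M₀ : AddSubgroup ℂ) (α β : ℂ) : Type :=
  (U M₀ ⊗[ℂ] V M₀) ⧸ indRel M₀ α β

/-- The canonical map `v ↦ 1 ⊗ v` from `V(α, β)` to `Ṽ(α, β)`. -/
def emb (M₀ : AddSubgroup ℂ) (α β : ℂ) : V M₀ →ₗ[ℂ] Vtilde M₀ α β :=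
  ((indRel M₀ α β).mkQ.restrictScalars ℂ).comp (TensorProduct.mk ℂ (U M₀) (V M₀) 1)

/-- The largest submodule `J` of `Ṽ(α, β)` that intersects `V(α, β)` trivially: the sum of all
submodules with that property. -/
def J (M₀ : AddSubgroup ℂ) (α β : ℂ) : Submodule (U M₀) (Vtilde M₀ α β) :=
  sSup {N | N.restrictScalars ℂ ⊓ LinearMap.range (emb M₀ α β) = ⊥}

/-- The quotient module `V̄(α, β) = Ṽ(α, β) / J`. -/
abbrev Vbar (M₀ : AddSubgroup ℂ) (α β : ℂ) : Type := Vtilde M₀ α β ⧸ J M₀ α β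

/-- The weight space `V̄_μ = {w ∈ V̄(α, β) | d₀ w = μ w}`. -/
def wt (M₀ : AddSubgroup ℂ) (α β μ : ℂ) : Submodule ℂ (Vbar M₀ α β) where
  carrier := {w | UniversalEnvelopingAlgebra.ι ℂ (d (0 : Idx M₀)) • w = μ • w}
  zero_mem' := by simp
  add_mem' {x y} hx hy := by
    simp only [Set.mem_ofPred_eq] at hx hy ⊢
    rw [smul_add, smul_add, hx, hy]
  smul_mem' c x hx := by
    simp only [Set.mem_ofPred_eq] at hx ⊢
    rw [smul_comm, hx, smul_comm]

end GenVir

end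

/-!
Let `π` be the projection of `Ṽ` onto `V(α, β)` that kills every product beginning with some `d_m`
of negative level; it is well defined because the prescription on `T(L) ⊗ V(α, β)` that sends such
products to zero and lets the other `d_m` act diagonally respects the brackets. Submodules are
graded by weights, so `J` consists of the `x` with `π (U x) = 0`, and `π` descends to `V̄`, where
`π (U w) = 0` forces `w = 0`.

Since `M₀ ≠ 0`, `L₁` generates `L₊`. Hence a vector `w` of weight `-i + α + s` in `V̄` is determined
by the scalars of `π (d_{1+c_1} ⋯ d_{1+c_i} w)` for `c_1, …, c_i` in `M₀`, and these are the values
at `c` of a polynomial of degree at most `2 i`. In this way the weight space becomes a space `E_s`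
of polynomials, and `d_x` with `x ∈ M₀` maps `E_s` to `E_{x+s}` by an operator that acts on the part
of degree `n` of the associated graded space as the scalar `s + α - i + x (β + i - n)`. When the
weights of `a_1` and `a_2` are non-zero, some `u ∈ M₀` makes the scalars of both steps
`a_1 → u → a_2` non-zero, and likewise backwards, so that `E_{a_1}` and `E_{a_2}` have the same
graded parts.
-/

noncomputable section

namespace GenVir

attribute [local instance] LieRing.ofAssociativeRing

open scoped TensorProduct

/-! ### Words in a family of operators -/

section Word

variable {ι R A : Type*} [AddCommMonoid ι] [CommSemiring R] [Semiring A] [Algebra R A]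

theorem mul_prod_map_eq_sum {ρ : ι → A} {a : A} {y : ι} {φ : ι → R}
    (h : ∀ n, a * ρ n = ρ n * a + φ n • ρ (y + n)) (l : List ι) :
    a * (l.map ρ).prod = ∑ q ∈ Finset.range l.length,
      φ (l.getD q 0) • ((l.modify q (y + ·)).map ρ).prod + (l.map ρ).prod * a := by
  induction l with
  | nil => simp
  | cons n l ih =>
    rw [List.map_cons, List.prod_cons, ← mul_assoc, h, add_mul, mul_assoc, ih, List.length_cons,
      Finset.sum_range_succ']
    simp only [List.getD_cons_succ, List.getD_cons_zero, List.modify_succ_cons,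
      List.modify_zero_cons, List.map_cons, List.prod_cons, mul_add, Finset.mul_sum,
      mul_smul_comm, smul_mul_assoc, mul_assoc]
    abel

theorem sum_modify_add (y : ι) {l : List ι} {q : ℕ} (hq : q < l.length) :
    (l.modify q (y + ·)).sum = y + l.sum := by
  induction l generalizing q with
  | nil => simp at hq
  | cons n l ih =>
    cases q with
    | zero => simp [add_assoc]
    | succ q =>
      rw [List.modify_succ_cons, List.sum_cons, ih (by simpa using hq), List.sum_cons,
        add_left_comm]

theorem map_modify_add {κ : Type*} [AddCommMonoid κ] (f : ι →+ κ) (y : ι) (l : List ι) (q : ℕ) :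
    (l.modify q (y + ·)).map f = (l.map f).modify q (f y + ·) := by
  induction l generalizing q with
  | nil => simp
  | cons n l ih => cases q <;> simp [ih]

theorem forall_mem_modify {κ : Type*} {p : κ → Prop} {l : List κ} {f : κ → κ} {q : ℕ}
    (hl : ∀ n ∈ l, p n) (hf : ∀ n, p n → p (f n)) : ∀ n ∈ l.modify q f, p n := by
  intro n hn
  obtain ⟨k, hk, rfl⟩ := List.getElem_of_mem hn
  have hnk := hl _ (List.getElem_mem (by simpa using hk : k < l.length))
  rw [List.getElem_modify]
  split_ifs
  exacts [hf _ hnk, hnk]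

end Word

/-! ### The scalar of a word on top vectors -/

section Coef

variable {R S : Type*} [CommRing R] [CommRing S]

/-- The coefficient of `v_{b + a_1 + ⋯ + a_k}` in `d_{y_1} ⋯ d_{y_k} v_b`, where `y_j = i_j + a_j`
and `i_1 + ⋯ + i_k = 0`: a first letter with `i_1 < 0` cannot contribute, any other is commuted to
the right until it acts on `v_b`. The ring is arbitrary because the letters will also be taken with
polynomial entries. -/
def coef (α β : R) : List (ℤ × R) → R → R
  | [], _ => 1
  | y :: l, b => if y.1 < 0 then 0 else
      ∑ q ∈ Finset.range l.length,
        (((l.getD q 0).1 : R) + (l.getD q 0).2 - (y.1 + y.2)) * coef α β (l.modify q (y + ·)) b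
      + if y.1 = 0 then (b + α + y.2 * β) * coef α β l (b + y.2) else 0
termination_by l => l.length

theorem coef_nil (α β b : R) : coef α β [] b = 1 := by rw [coef]

theorem coef_map_cons {ι : Type*} [AddCommMonoid ι] (α β b : R) (f : ι →+ ℤ × R) (y : ι)
    (l : List ι) :
    coef α β ((y :: l).map f) b = if (f y).1 < 0 then 0 else
      ∑ q ∈ Finset.range l.length,
        (((f (l.getD q 0)).1 : R) + (f (l.getD q 0)).2 - ((f y).1 + (f y).2)) *
          coef α β ((l.modify q (y + ·)).map f) b
      + if (f y).1 = 0 then (b + α + (f y).2 * β) * coef α β (l.map f) (b + (f y).2) else 0 := by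
  have hget (q : ℕ) : (l.map f).getD q 0 = f (l.getD q 0) := by
    simpa only [map_zero] using List.getD_map (l := l) (d := 0) (n := q) f
  rw [List.map_cons, coef, List.length_map]
  simp only [hget, map_modify_add]

theorem map_coef (φ : R →+* S) (α β : R) (l : List (ℤ × R)) (b : R) :
    φ (coef α β l b) = coef (φ α) (φ β) (l.map ((AddMonoidHom.id ℤ).prodMap φ)) (φ b) := by
  have hfst (y : ℤ × R) : ((AddMonoidHom.id ℤ).prodMap (φ : R →+ S) y).1 = y.1 := rfl
  induction l, b using coef.induct with
  | case1 b => rw [coef_nil, map_one, List.map_nil, coef_nil]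
  | case2 y l b hy => rw [coef_map_cons, coef, hfst, if_pos hy, if_pos hy, map_zero]
  | case3 y l b hy ih ih' =>
    rw [coef_map_cons, coef, hfst, if_neg hy, if_neg hy, map_add, map_sum, apply_ite φ]
    simp only [map_mul, map_sub, map_add, map_intCast, map_zero, ih, ih']
    rfl

open MvPolynomial in
theorem totalDegree_coef_le {σ : Type*} (α β : R) (l : List (ℤ × MvPolynomial σ R))
    (b : MvPolynomial σ R) (hl : ∀ y ∈ l, y.2.totalDegree ≤ 1) (hb : b.totalDegree ≤ 1) :
    (coef (C α) (C β) l b).totalDegree ≤ l.length := by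
  have hadd {p q : MvPolynomial σ R} (hp : p.totalDegree ≤ 1) (hq : q.totalDegree ≤ 1) :
      (p + q).totalDegree ≤ 1 := (totalDegree_add p q).trans (max_le hp hq)
  have hint (z : ℤ) : (z : MvPolynomial σ R).totalDegree ≤ 1 := by
    rw [← map_intCast (C : R →+* MvPolynomial σ R) z, totalDegree_C]; exact zero_le_one
  have hmul {p q : MvPolynomial σ R} {k : ℕ} (hp : p.totalDegree ≤ 1) (hq : q.totalDegree ≤ k) :
      (p * q).totalDegree ≤ k + 1 :=
    (totalDegree_mul p q).trans (by omega)
  induction l, b using coef.induct with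
  | case1 b => simp [coef_nil]
  | case2 y l b hy => simp [coef, hy]
  | case3 y l b hy ih ih' =>
    obtain ⟨hy₁, hl⟩ := List.forall_mem_cons.1 hl
    have hget (q : ℕ) : (l.getD q 0).2.totalDegree ≤ 1 := by
      by_cases hq : q < l.length
      · rw [List.getD_eq_getElem l 0 hq]; exact hl _ (List.getElem_mem hq)
      · rw [List.getD_eq_default l 0 (not_lt.1 hq), Prod.snd_zero, totalDegree_zero]
        exact zero_le_one
    rw [coef, if_neg hy, List.length_cons]
    refine (totalDegree_add _ _).trans (max_le (totalDegree_finsetSum_le fun q _ => hmul ?_ ?_) ?_)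
    · exact (totalDegree_sub _ _).trans (max_le (hadd (hint _) (hget q)) (hadd (hint _) hy₁))
    · simpa only [List.length_modify] using ih q (forall_mem_modify hl fun z hz => hadd hy₁ hz) hb
    · split_ifs
      · exact hmul (hadd (hadd hb (by simp)) ((totalDegree_mul _ _).trans (by simpa using hy₁)))
          (ih' hl (hadd hb hy₁))
      · simp

end Coef

/-! ### Polynomials filtered by degree -/

section Filtration

variable {K M : Type*} [DivisionRing K] [AddCommGroup M] [Module K M]

theorem rank_inf_eq_rank_map_mkQ_add {F F' : Submodule K M} (hF : F ≤ F') (E : Submodule K M) :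
    Module.rank K ↥(E ⊓ F') = Module.rank K ((E ⊓ F').map F.mkQ) + Module.rank K ↥(E ⊓ F) := by
  have hker : LinearMap.ker (F.mkQ.domRestrict (E ⊓ F')) = (E ⊓ F).comap (E ⊓ F').subtype := by
    ext ⟨p, hp⟩
    simpa using fun _ => hp.1
  rw [← LinearMap.rank_range_add_rank_ker (F.mkQ.domRestrict (E ⊓ F')), LinearMap.range_domRestrict,
    hker, (Submodule.comapSubtypeEquivOfLe (inf_le_inf_left E hF)).rank_eq]

theorem rank_eq_of_map_mkQ_eq {F : ℕ → Submodule K M} (hF : Monotone F) (hF₀ : F 0 = ⊥)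
    {E E' : Submodule K M}
    (h : ∀ n, (E ⊓ F (n + 1)).map (F n).mkQ = (E' ⊓ F (n + 1)).map (F n).mkQ) {n : ℕ}
    (hE : E ≤ F n) (hE' : E' ≤ F n) : Module.rank K E = Module.rank K E' := by
  have hrank (n : ℕ) : Module.rank K ↥(E ⊓ F n) = Module.rank K ↥(E' ⊓ F n) := by
    induction n with
    | zero => rw [hF₀, inf_bot_eq, inf_bot_eq]
    | succ n ih =>
      rw [rank_inf_eq_rank_map_mkQ_add (hF n.le_succ), rank_inf_eq_rank_map_mkQ_add (hF n.le_succ),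
        h, ih]
  rw [← inf_eq_left.2 hE, hrank, inf_eq_left.2 hE']

end Filtration

section Poly

open MvPolynomial

variable {σ R : Type*} [CommRing R]

variable (σ R) in
/-- The polynomials of total degree less than `n`. With the strict inequality, unlike in
`restrictTotalDegree`, the filtration by `n : ℕ` starts with zero. -/
def degreeLT (n : ℕ) : Submodule R (MvPolynomial σ R) := restrictSupport R {e | e.degree < n}

theorem degreeLT_mono : Monotone (degreeLT σ R) := fun _ _ h =>
  restrictSupport_mono R fun _ he => lt_of_lt_of_le he h

theorem monomial_mem_degreeLT {e : σ →₀ ℕ} {n : ℕ} (h : e.degree < n) (c : R) :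
    monomial e c ∈ degreeLT σ R n :=
  (mem_restrictSupport_iff R).2 fun _ he => by
    rwa [Finset.mem_singleton.1 (support_monomial_subset he)]

theorem degreeLT_le_iff {n : ℕ} {W : Submodule R (MvPolynomial σ R)} :
    degreeLT σ R n ≤ W ↔ ∀ e : σ →₀ ℕ, e.degree < n → monomial e 1 ∈ W := by
  rw [degreeLT, restrictSupport_eq_span, Submodule.span_le]
  exact Set.image_subset_iff

theorem degreeLT_zero : degreeLT σ R 0 = ⊥ := by
  rw [eq_bot_iff, degreeLT_le_iff]
  exact fun _ he => absurd he (Nat.not_lt_zero _)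

theorem mem_degreeLT_of_totalDegree_lt {p : MvPolynomial σ R} {n : ℕ} (h : p.totalDegree < n) :
    p ∈ degreeLT σ R n :=
  (mem_restrictSupport_iff R).2 fun _ he => (le_totalDegree he).trans_lt h

theorem mul_X_mem_degreeLT {n : ℕ} (k : σ) {p : MvPolynomial σ R} (hp : p ∈ degreeLT σ R n) :
    p * X k ∈ degreeLT σ R (n + 1) := by
  suffices degreeLT σ R n ≤ (degreeLT σ R (n + 1)).comap (LinearMap.mulRight R (X k)) from this hp
  rw [degreeLT_le_iff]
  intro e he
  rw [Submodule.mem_comap, LinearMap.mulRight_apply, X, monomial_mul, one_mul]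
  exact monomial_mem_degreeLT (by simpa using he) 1

theorem monomial_degree_induction {P : ℕ → MvPolynomial σ R → Prop} (one : P 0 1)
    (mul_X : ∀ n p k, P n p → P (n + 1) (p * X k)) (e : σ →₀ ℕ) : P e.degree (monomial e 1) := by
  induction h : e.degree generalizing e with
  | zero =>
    rw [(Finsupp.degree_eq_zero_iff e).1 h]
    exact one
  | succ n ih =>
    obtain ⟨k, hk⟩ : ∃ k, e k ≠ 0 := by
      by_contra! he
      rw [Finsupp.ext (g := 0) he] at h
      simp at h
    obtain ⟨e, rfl⟩ : ∃ e', e = e' + Finsupp.single k 1 := ⟨e - Finsupp.single k 1,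
        (tsub_add_cancel_of_le (Finsupp.single_le_iff.2 (Nat.one_le_iff_ne_zero.2 hk))).symm⟩
    have hX : (monomial (e + Finsupp.single k 1) 1 : MvPolynomial σ R) = monomial e 1 * X k := by
      rw [X, monomial_mul, one_mul]
    rw [hX]
    exact mul_X n _ k (ih e (by simpa using h))

variable [DecidableEq σ]

/-- The translation `p(X) ↦ p(X + x e_j)`. -/
def shift (j : σ) (x : R) : MvPolynomial σ R →ₐ[R] MvPolynomial σ R :=
  aeval fun k => X k + C (Pi.single (M := fun _ => R) j x k)

theorem shift_X (j k : σ) (x : R) :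
    shift j x (X k) = X k + C (Pi.single (M := fun _ => R) j x k) := aeval_X _ _

theorem eval_shift (j : σ) (x : R) (c : σ → R) (p : MvPolynomial σ R) :
    eval c (shift j x p) = eval (c + Pi.single j x) p := by
  induction p using MvPolynomial.induction_on with
  | C r => simp [shift]
  | add p q hp hq => simp only [map_add, hp, hq]
  | mul_X p k hp => simp only [map_mul, map_add, hp, shift_X, eval_X, eval_C, Pi.add_apply]

theorem shift_sub_mem_degreeLT (j : σ) (x : R) {n : ℕ} {p : MvPolynomial σ R}
    (hp : p ∈ degreeLT σ R (n + 1)) : shift j x p - p ∈ degreeLT σ R n := by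
  have hmonomial (e : σ →₀ ℕ) : monomial e 1 ∈ degreeLT σ R (e.degree + 1) ∧
      shift j x (monomial e 1) - monomial e 1 ∈ degreeLT σ R e.degree := by
    refine monomial_degree_induction
      (P := fun n p => p ∈ degreeLT σ R (n + 1) ∧ shift j x p - p ∈ degreeLT σ R n) ?_ ?_ e
    · exact ⟨mem_degreeLT_of_totalDegree_lt (by simp), by simp⟩
    · rintro n p k ⟨hp, hs⟩
      refine ⟨mul_X_mem_degreeLT k hp, ?_⟩
      have hmul : shift j x (p * X k) - p * X k = (shift j x p - p) * X k
          + Pi.single (M := fun _ => R) j x k • ((shift j x p - p) + p) := by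
        rw [map_mul, shift_X, smul_eq_C_mul]
        ring
      rw [hmul]
      exact add_mem (mul_X_mem_degreeLT k hs)
        (Submodule.smul_mem _ _ (add_mem (degreeLT_mono n.le_succ hs) hp))
  suffices degreeLT σ R (n + 1) ≤ (degreeLT σ R n).comap ((shift j x).toLinearMap - LinearMap.id)
    from this hp
  exact degreeLT_le_iff.2 fun e he => degreeLT_mono (Nat.le_of_lt_succ he) (hmonomial e).2

variable [Fintype σ]

/-- The action of `d_x`, for `x ∈ M₀`, on the polynomials describing vectors of weight
`-i + s + α` (see `Describes`), where `i` is the number of variables and `a = s + α + x β`. -/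
def polyOp (a x : R) : Module.End R (MvPolynomial σ R) :=
  LinearMap.mulLeft R (C a + ∑ j, X j)
    + ∑ j, LinearMap.mulLeft R (C (x - 1) - X j) ∘ₗ (shift j x).toLinearMap

theorem polyOp_apply (a x : R) (p : MvPolynomial σ R) :
    polyOp a x p = (C a + ∑ j, X j) * p + ∑ j, (C (x - 1) - X j) * shift j x p := by
  simp [polyOp]

theorem eval_polyOp (a x : R) (c : σ → R) (p : MvPolynomial σ R) :
    eval c (polyOp a x p) = (a + ∑ j, c j) * eval c p
      + ∑ j, (x - 1 - c j) * eval (c + Pi.single j x) p := by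
  simp [polyOp_apply, eval_shift]

theorem polyOp_mul_X (a x : R) (p : MvPolynomial σ R) (k : σ) :
    polyOp a x (p * X k) = polyOp a x p * X k + C x * ((C (x - 1) - X k) * shift k x p) := by
  have hshift (j : σ) : (C (x - 1) - X j) * shift j x (p * X k)
      = (C (x - 1) - X j) * shift j x p * X k
        + if k = j then C x * ((C (x - 1) - X k) * shift k x p) else 0 := by
    rw [map_mul, shift_X, Pi.single_apply]
    split_ifs with hk
    · subst hk; ring
    · simp [mul_assoc]
  simp only [polyOp_apply, hshift, Finset.sum_add_distrib, Finset.sum_ite_eq, Finset.mem_univ,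
    if_true, ← Finset.sum_mul]
  ring

theorem polyOp_monomial_sub_mem_degreeLT (a x : R) (e : σ →₀ ℕ) :
    polyOp a x (monomial e 1) - (a + Fintype.card σ * (x - 1) - x * e.degree) • monomial e 1
      ∈ degreeLT σ R e.degree := by
  suffices monomial e 1 ∈ degreeLT σ R (e.degree + 1) ∧
    polyOp a x (monomial e 1) - (a + Fintype.card σ * (x - 1) - x * e.degree) • monomial e 1
      ∈ degreeLT σ R e.degree from this.2
  refine monomial_degree_induction (P := fun n p => p ∈ degreeLT σ R (n + 1) ∧
    polyOp a x p - (a + Fintype.card σ * (x - 1) - x * n) • p ∈ degreeLT σ R n) ?_ ?_ e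
  · refine ⟨mem_degreeLT_of_totalDegree_lt (by simp), ?_⟩
    simp only [polyOp_apply, smul_eq_C_mul, map_one, mul_one, Nat.cast_zero, mul_zero, sub_zero,
      Finset.sum_sub_distrib, Finset.sum_const, Finset.card_univ, nsmul_eq_mul, map_add, map_mul,
      map_natCast, degreeLT_zero, Submodule.mem_bot]
    ring
  · rintro n p k ⟨hp, hop⟩
    refine ⟨mul_X_mem_degreeLT k hp, ?_⟩
    have hs := shift_sub_mem_degreeLT k x hp
    have hmul : polyOp a x (p * X k)
          - (a + Fintype.card σ * (x - 1) - x * ((n + 1 : ℕ) : R)) • (p * X k)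
        = (polyOp a x p - (a + Fintype.card σ * (x - 1) - x * n) • p) * X k
          + ((x * (x - 1)) • ((shift k x p - p) + p) - x • ((shift k x p - p) * X k)) := by
      rw [polyOp_mul_X]
      simp only [smul_eq_C_mul, map_sub, map_add, map_mul, map_natCast, map_one, Nat.cast_succ]
      ring
    rw [hmul]
    exact add_mem (mul_X_mem_degreeLT k hop) (sub_mem
      (Submodule.smul_mem _ _ (add_mem (degreeLT_mono n.le_succ hs) hp))
      (Submodule.smul_mem _ _ (mul_X_mem_degreeLT k hs)))

/-- On the associated graded space of the degree filtration `polyOp` acts by scalars. -/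
theorem polyOp_sub_mem_degreeLT (a x : R) {n : ℕ} {p : MvPolynomial σ R}
    (hp : p ∈ degreeLT σ R (n + 1)) :
    polyOp a x p - (a + Fintype.card σ * (x - 1) - x * n) • p ∈ degreeLT σ R n := by
  suffices degreeLT σ R (n + 1) ≤ (degreeLT σ R n).comap
    (polyOp a x - (a + Fintype.card σ * (x - 1) - x * n) • LinearMap.id) from this hp
  refine degreeLT_le_iff.2 fun e he => ?_
  rw [Submodule.mem_comap, LinearMap.sub_apply, LinearMap.smul_apply, LinearMap.id_apply]
  have hmonomial := polyOp_monomial_sub_mem_degreeLT a x e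
  rcases (Nat.le_of_lt_succ he).eq_or_lt with rfl | he
  · exact hmonomial
  · rw [← sub_add_sub_cancel, ← sub_smul]
    exact add_mem (degreeLT_mono he.le hmonomial)
      (Submodule.smul_mem _ _ (monomial_mem_degreeLT he 1))

end Poly

section GradedRank

open MvPolynomial

variable {σ K : Type*} [DecidableEq σ] [Fintype σ] [Field K] {G : AddSubgroup K} {α β : K}
  {E : G → Submodule K (MvPolynomial σ K)}

theorem map_mkQ_le_of_polyOp (hE : ∀ x s : G, ∀ p ∈ E s, polyOp (s + α + x * β) x p ∈ E (x + s))
    {n : ℕ} {x s : G} (h : (s : K) + α - Fintype.card σ + x * (β + Fintype.card σ - n) ≠ 0) :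
    (E s ⊓ degreeLT σ K (n + 1)).map (degreeLT σ K n).mkQ
      ≤ (E (x + s) ⊓ degreeLT σ K (n + 1)).map (degreeLT σ K n).mkQ := by
  rintro _ ⟨p, ⟨hps, hpn⟩, rfl⟩
  set κ := (s : K) + α - Fintype.card σ + x * (β + Fintype.card σ - n) with hκ
  have hlead : polyOp (s + α + x * β) x p - κ • p ∈ degreeLT σ K n := by
    convert polyOp_sub_mem_degreeLT (s + α + x * β) x.1 hpn using 3
    rw [hκ]
    ring
  refine ⟨κ⁻¹ • polyOp (s + α + x * β) x p, ⟨Submodule.smul_mem _ _ (hE x s p hps),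
    Submodule.smul_mem _ _ ?_⟩, ?_⟩
  · rw [← sub_add_cancel (polyOp (s + α + x * β) (x : K) p) (κ • p)]
    exact add_mem (degreeLT_mono n.le_succ hlead) (Submodule.smul_mem _ _ hpn)
  · rw [Submodule.mkQ_apply, Submodule.mkQ_apply, Submodule.Quotient.eq,
      ← inv_smul_smul₀ h p, ← smul_sub, inv_smul_smul₀ h]
    exact Submodule.smul_mem _ _ hlead

theorem finite_setOf_add_mul_eq_zero {a b : K} {t : G} (ht : a + t * b ≠ 0) :
    {u : G | a + (u : K) * b = 0}.Finite := by
  refine Set.Subsingleton.finite fun u (hu : _ = _) u' (hu' : _ = _) => ?_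
  have hb : b ≠ 0 := by
    rintro rfl
    exact ht (by simpa using hu)
  exact Subtype.ext (mul_right_cancel₀ hb (by linear_combination hu - hu'))

variable [Infinite G]

/-- Translating by `t - s` in one step may meet a zero scalar; a detour through a third element of
`G` avoids it. -/
theorem map_mkQ_le_of_polyOp_of_ne
    (hE : ∀ x s : G, ∀ p ∈ E s, polyOp (s + α + x * β) x p ∈ E (x + s)) (n : ℕ) {s t : G}
    (hs : (s : K) + α - Fintype.card σ ≠ 0) (ht : (t : K) + α - Fintype.card σ ≠ 0) :
    (E s ⊓ degreeLT σ K (n + 1)).map (degreeLT σ K n).mkQ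
      ≤ (E t ⊓ degreeLT σ K (n + 1)).map (degreeLT σ K n).mkQ := by
  set γ := β + Fintype.card σ - n
  have hfirst : ((s : K) + α - Fintype.card σ - s * γ) + s * γ ≠ 0 := by simpa using hs
  have hsecond : (α - Fintype.card σ + t * γ) + t * (1 - γ) ≠ 0 := by
    convert ht using 1; ring
  obtain ⟨u, hu⟩ := ((finite_setOf_add_mul_eq_zero hfirst).union
    (finite_setOf_add_mul_eq_zero hsecond)).exists_notMem
  rw [Set.mem_union, not_or] at hu
  have hsu : (s : K) + α - Fintype.card σ + ↑(u - s) * γ ≠ 0 := fun h =>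
    hu.1 (show _ = (0 : K) by rw [AddSubgroup.coe_sub] at h; linear_combination h)
  have hut : (u : K) + α - Fintype.card σ + ↑(t - u) * γ ≠ 0 := fun h =>
    hu.2 (show _ = (0 : K) by rw [AddSubgroup.coe_sub] at h; linear_combination h)
  have hle := map_mkQ_le_of_polyOp hE hsu
  have hle' := map_mkQ_le_of_polyOp hE hut
  rw [sub_add_cancel] at hle hle'
  exact hle.trans hle'

theorem rank_eq_of_polyOp
    (hE : ∀ x s : G, ∀ p ∈ E s, polyOp (s + α + x * β) x p ∈ E (x + s)) {n : ℕ}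
    (hn : ∀ s, E s ≤ degreeLT σ K n) {s t : G} (hs : (s : K) + α - Fintype.card σ ≠ 0)
    (ht : (t : K) + α - Fintype.card σ ≠ 0) : Module.rank K (E s) = Module.rank K (E t) :=
  rank_eq_of_map_mkQ_eq degreeLT_mono degreeLT_zero (fun n =>
    le_antisymm (map_mkQ_le_of_polyOp_of_ne hE n hs ht) (map_mkQ_le_of_polyOp_of_ne hE n ht hs))
    (hn s) (hn t)

end GradedRank

/-! ### Representations of `L` and the induced module -/

section Rep

variable {M₀ : AddSubgroup ℂ} {E : Type*} [AddCommGroup E] [Module ℂ E]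

/-- The representation of `L` by operators with the commutation relations of the `d m`. -/
def repHom (ρ : Idx M₀ → Module.End ℂ E)
    (h : ∀ m n, ρ m * ρ n = ρ n * ρ m + (val n - val m) • ρ (m + n)) :
    L M₀ →ₗ⁅ℂ⁆ Module.End ℂ E where
  toLinearMap := ext ρ
  map_lie' {x y} := by
    change ext ρ ⁅x, y⁆ = ⁅ext ρ x, ext ρ y⁆
    induction x using induction_d with
    | h0 => simp
    | hadd x x' h h' => simp only [map_add, add_lie, h, h']
    | hsmul c x h => simp only [map_smul, smul_lie, h]
    | hd m =>
    induction y using induction_d with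
    | h0 => simp
    | hadd x x' h h' => simp only [map_add, lie_add, h, h']
    | hsmul c x h => simp only [map_smul, lie_smul, h]
    | hd n =>
    rw [lie_d, map_smul, ext_d, ext_d, ext_d, LieRing.of_associative_ring_bracket, h m n,
      add_sub_cancel_left]

variable [Module (U M₀) E] [IsScalarTower ℂ (U M₀) E] {α β : ℂ}

theorem d_smul_emb {m : Idx M₀} (hm : 0 ≤ m.1) (w : V M₀) :
    UniversalEnvelopingAlgebra.ι ℂ (d m) • emb M₀ α β w = emb M₀ α β (act α β (d m) w) := by
  have hmem : d m ∈ nonneg M₀ := Submodule.subset_span ⟨m, hm, rfl⟩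
  change (indRel M₀ α β).mkQ (UniversalEnvelopingAlgebra.ι ℂ (d m) • ((1 : U M₀) ⊗ₜ[ℂ] w))
    = (indRel M₀ α β).mkQ (1 ⊗ₜ[ℂ] rho M₀ α β ⟨d m, hmem⟩ w)
  rw [TensorProduct.smul_tmul', smul_eq_mul, mul_one, ← sub_eq_zero, ← map_sub,
    Submodule.mkQ_apply, Submodule.Quotient.mk_eq_zero]
  exact Submodule.subset_span ⟨⟨d m, hmem⟩, w, rfl⟩

theorem exists_lift_Vtilde (f : V M₀ →ₗ[ℂ] E)
    (hf : ∀ m : Idx M₀, 0 ≤ m.1 → ∀ w,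
      UniversalEnvelopingAlgebra.ι ℂ (d m) • f w = f (act α β (d m) w)) :
    ∃ F : Vtilde M₀ α β →ₗ[U M₀] E, ∀ w, F (emb M₀ α β w) = f w := by
  have hnonneg (x : L M₀) (hx : x ∈ nonneg M₀) (w : V M₀) :
      UniversalEnvelopingAlgebra.ι ℂ x • f w = f (act α β x w) := by
    change x ∈ Submodule.span ℂ (d '' {m : Idx M₀ | 0 ≤ m.1}) at hx
    induction hx using Submodule.span_induction with
    | mem x hx =>
      obtain ⟨m, hm, rfl⟩ := hx
      exact hf m hm w
    | zero => simp
    | add x y _ _ hx hy => simp only [map_add, LinearMap.add_apply, add_smul, hx, hy]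
    | smul c x _ hx => simp only [map_smul, LinearMap.smul_apply, smul_assoc, hx]
  let T : U M₀ ⊗[ℂ] V M₀ →ₗ[U M₀] E :=
    TensorProduct.AlgebraTensorModule.lift (LinearMap.toSpanSingleton (U M₀) (V M₀ →ₗ[ℂ] E) f)
  have hT (u : U M₀) (w : V M₀) : T (u ⊗ₜ w) = u • f w := by simp [T]
  refine ⟨(indRel M₀ α β).liftQ T (Submodule.span_le.2 ?_), fun w => ?_⟩
  · rintro _ ⟨x, w, rfl⟩
    rw [SetLike.mem_coe, LinearMap.mem_ker, map_sub, hT, hT, one_smul, sub_eq_zero]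
    exact hnonneg x x.2 w
  · exact (hT 1 w).trans (one_smul _ _)

end Rep

/-! ### The projection of the induced module onto its top level -/

section TopCoefficient

variable {M₀ : AddSubgroup ℂ} {α β : ℂ}

variable (M₀) in
/-- The inclusion of `M = ℤ ⊕ M₀` into `ℤ ⊕ ℂ`, where the letters of `coef` live. -/
def coords : Idx M₀ →+ ℤ × ℂ := (AddMonoidHom.id ℤ).prodMap M₀.subtype

theorem coords_apply (m : Idx M₀) : coords M₀ m = (m.1, (m.2 : ℂ)) := rfl

/-- The component in `V(α, β)` of `d_{m_1} ⋯ d_{m_k} v_b`, for a word `m_1, …, m_k` in `M`. -/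
def topCoef (α β : ℂ) (l : List (Idx M₀)) (b : M₀) : V M₀ :=
  coef α β (l.map (coords M₀)) (b : ℂ) • v (l.sum.2 + b)

theorem topCoef_nil (b : M₀) : topCoef α β [] b = v b := by
  simp [topCoef, coef_nil]

theorem topCoef_cons_of_neg {y : Idx M₀} (hy : y.1 < 0) (l : List (Idx M₀)) (b : M₀) :
    topCoef α β (y :: l) b = 0 := by
  rw [topCoef, coef_map_cons, coords_apply, if_pos hy, zero_smul]

theorem topCoef_cons_of_nonneg {y : Idx M₀} (hy : 0 ≤ y.1) (l : List (Idx M₀)) (b : M₀) :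
    topCoef α β (y :: l) b = ∑ q ∈ Finset.range l.length,
        (val (l.getD q 0) - val y) • topCoef α β (l.modify q (y + ·)) b
      + extV (topCoef α β l) (act α β (d y) (v b)) := by
  have hlast : extV (topCoef α β l) (act α β (d y) (v b)) = (if y.1 = 0 then
      (b + α + y.2 * β) * coef α β (l.map (coords M₀)) (b + y.2)
      else 0) • v ((y :: l).sum.2 + b) := by
    obtain ⟨i, a⟩ := y
    split_ifs with hi
    · obtain rfl : i = 0 := hi
      rw [act_d, map_smul, extV_v, topCoef, smul_smul, List.sum_cons, Prod.snd_add,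
        AddSubgroup.coe_add, add_comm (a : ℂ), add_assoc a, add_left_comm]
    · rw [act_d_of_ne _ _ _ hi, LinearMap.zero_apply, map_zero, zero_smul]
  rw [topCoef, coef_map_cons, coords_apply, if_neg hy.not_gt, add_smul, Finset.sum_smul, hlast]
  congr 1
  refine Finset.sum_congr rfl fun q hq => ?_
  rw [topCoef, sum_modify_add y (Finset.mem_range.1 hq), List.sum_cons, mul_smul]
  rfl

end TopCoefficient

section Free

variable {M₀ : AddSubgroup ℂ} {α β : ℂ}

variable (M₀) in
/-- The space `T(L) ⊗ V(α, β)`, with basis the tensors `d_{m_1} ⊗ ⋯ ⊗ d_{m_k} ⊗ v_b`. The induced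
module is a quotient of it. -/
abbrev Free : Type := (List (Idx M₀) × M₀) →₀ ℂ

/-- Left multiplication by `d_m` on `T(L) ⊗ V(α, β)`. -/
def letter (m : Idx M₀) : Module.End ℂ (Free M₀) :=
  Finsupp.lmapDomain ℂ ℂ fun k => (m :: k.1, k.2)

/-- The embedding of `V(α, β)` into `T(L) ⊗ V(α, β)`. -/
def top : V M₀ →ₗ[ℂ] Free M₀ := extV fun b => Finsupp.single ([], b) 1

theorem top_v (b : M₀) : top (v b) = Finsupp.single ([], b) 1 := extV_v _ b

theorem word_letter_top (l : List (Idx M₀)) (b : M₀) :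
    (l.map letter).prod (top (v b)) = Finsupp.single (l, b) 1 := by
  induction l with
  | nil => exact top_v b
  | cons m l ih => simp [ih, letter]

theorem free_hom_ext {W : Type*} [AddCommGroup W] [Module ℂ W] {f g : Free M₀ →ₗ[ℂ] W}
    (h : ∀ (l : List (Idx M₀)) (b : M₀),
      f ((l.map letter).prod (top (v b))) = g ((l.map letter).prod (top (v b)))) : f = g :=
  Finsupp.lhom_ext' fun k => LinearMap.ext_ring (by simpa [word_letter_top] using h k.1 k.2)

theorem free_hom_ext_cons {W : Type*} [AddCommGroup W] [Module ℂ W] {f g : Free M₀ →ₗ[ℂ] W}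
    (htop : ∀ w, f (top w) = g (top w))
    (hletter : ∀ n t, f t = g t → f (letter n t) = g (letter n t)) : f = g := by
  refine free_hom_ext fun l b => ?_
  induction l with
  | nil => exact htop _
  | cons n l ih => simpa using hletter n _ ih

/-- The values of `diag` on basis vectors. -/
def diagVal (α β : ℂ) (y : Idx M₀) : List (Idx M₀) → M₀ → Free M₀
  | [], b => top (act α β (d y) (v b))
  | n :: l, b => letter n (diagVal α β y l b) + (val n - val y) • Finsupp.single ((y + n) :: l, b) 1

/-- The diagonal action of `d_y` on `T(L) ⊗ V(α, β)`, where `L` acts on `T(L)` by derivations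
extending the adjoint action. It is an action of `L₊ + L₀` only. -/
def diag (α β : ℂ) (y : Idx M₀) : Module.End ℂ (Free M₀) :=
  Finsupp.linearCombination ℂ fun k => diagVal α β y k.1 k.2

theorem diag_top (y : Idx M₀) (w : V M₀) : diag α β y (top w) = top (act α β (d y) w) := by
  suffices diag α β y ∘ₗ top = top ∘ₗ act α β (d y) from LinearMap.congr_fun this w
  exact homV_ext fun b => by simp [top_v, diag, diagVal]

theorem diag_mul_letter (y n : Idx M₀) :
    diag α β y * letter n = letter n * diag α β y + (val n - val y) • letter (y + n) :=
  free_hom_ext fun l b => by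
    simp [word_letter_top, letter, diag, diagVal]

theorem diag_letter_apply (y n : Idx M₀) (t : Free M₀) : diag α β y (letter n t)
    = letter n (diag α β y t) + (val n - val y) • letter (y + n) t :=
  LinearMap.congr_fun (diag_mul_letter y n) t

theorem diag_mul_diag {x y : Idx M₀} (hx : 0 ≤ x.1) (hy : 0 ≤ y.1) :
    diag α β x * diag α β y
      = diag α β y * diag α β x + (val y - val x) • diag α β (x + y) := by
  refine free_hom_ext_cons (fun w => ?_) fun n t ih => ?_
  · simp only [Module.End.mul_apply, LinearMap.add_apply, LinearMap.smul_apply, diag_top]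
    rw [← map_smul, ← LinearMap.smul_apply, ← map_smul, ← lie_d, act_lie_d _ _ _ _ hx hy, ← map_add]
    simp
  · simp only [Module.End.mul_apply, LinearMap.add_apply, LinearMap.smul_apply] at ih ⊢
    simp only [diag_letter_apply, map_add, map_smul, ih, add_left_comm y x n,
      ← add_assoc x y n, val_add]
    module

/-- The component in `V(α, β)` of the image of a tensor in the induced module. -/
def freeProj (α β : ℂ) : Free M₀ →ₗ[ℂ] V M₀ :=
  Finsupp.linearCombination ℂ fun k => topCoef α β k.1 k.2

theorem freeProj_word_top (l : List (Idx M₀)) (w : V M₀) :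
    freeProj α β ((l.map letter).prod (top w)) = extV (topCoef α β l) w := by
  suffices freeProj α β ∘ₗ (l.map letter).prod ∘ₗ top = extV (topCoef α β l) from
    LinearMap.congr_fun this w
  exact homV_ext fun b => by simp [word_letter_top, freeProj, extV_v]

theorem freeProj_top (w : V M₀) : freeProj α β (top w) = w := by
  suffices freeProj α β ∘ₗ top = LinearMap.id from LinearMap.congr_fun this w
  exact homV_ext fun b => by simp [top_v, freeProj, topCoef_nil]

theorem freeProj_letter_of_neg {y : Idx M₀} (hy : y.1 < 0) (t : Free M₀) :
    freeProj α β (letter y t) = 0 := by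
  suffices freeProj α β ∘ₗ letter y = 0 from LinearMap.congr_fun this t
  refine free_hom_ext fun l b => ?_
  have h := freeProj_word_top (α := α) (β := β) (y :: l) (v b)
  rwa [extV_v, topCoef_cons_of_neg hy] at h

theorem freeProj_letter_of_nonneg {y : Idx M₀} (hy : 0 ≤ y.1) (t : Free M₀) :
    freeProj α β (letter y t) = freeProj α β (diag α β y t) := by
  suffices freeProj α β ∘ₗ letter y = freeProj α β ∘ₗ diag α β y from LinearMap.congr_fun this t
  refine free_hom_ext fun l b => ?_
  have h := freeProj_word_top (α := α) (β := β) (y :: l) (v b)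
  rw [extV_v, topCoef_cons_of_nonneg hy, List.map_cons, List.prod_cons, Module.End.mul_apply] at h
  have hdiag := LinearMap.congr_fun (mul_prod_map_eq_sum (diag_mul_letter (α := α) (β := β) y) l)
    (top (v b))
  simp only [Module.End.mul_apply, LinearMap.add_apply, LinearMap.sum_apply, LinearMap.smul_apply,
    diag_top] at hdiag
  rw [LinearMap.comp_apply, LinearMap.comp_apply, hdiag, map_add, map_sum, freeProj_word_top]
  simpa only [map_smul, freeProj_word_top, extV_v] using h

end Free

section Proj

variable {M₀ : AddSubgroup ℂ} {α β : ℂ}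

/-- The failure of left multiplication on `T(L) ⊗ V(α, β)` to respect the bracket of `d_x` and
`d_y`. -/
def bracketDefect (x y : Idx M₀) : Module.End ℂ (Free M₀) :=
  letter x * letter y - letter y * letter x - (val y - val x) • letter (x + y)

/-- The failure of left multiplication by `d_y` to extend the action on `V(α, β)`. -/
def topDefect (α β : ℂ) (y : Idx M₀) : V M₀ →ₗ[ℂ] Free M₀ :=
  letter y ∘ₗ top - top ∘ₗ act α β (d y)

variable (M₀ α β) in
/-- The space spanned by the defects: the induced module is the quotient of `T(L) ⊗ V(α, β)` by the
submodule of `T(L) ⊗ V(α, β)` generated by it. -/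
def relations : Submodule ℂ (Free M₀) :=
  (⨆ (x) (y), LinearMap.range (bracketDefect x y)) ⊔
    ⨆ (y : Idx M₀) (_ : 0 ≤ y.1), LinearMap.range (topDefect α β y)

theorem bracketDefect_mem_relations (x y : Idx M₀) (t : Free M₀) :
    bracketDefect x y t ∈ relations M₀ α β :=
  Submodule.mem_sup_left <| Submodule.mem_iSup_of_mem x <| Submodule.mem_iSup_of_mem y ⟨t, rfl⟩

theorem topDefect_mem_relations {y : Idx M₀} (hy : 0 ≤ y.1) (w : V M₀) :
    topDefect α β y w ∈ relations M₀ α β :=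
  Submodule.mem_sup_right <| Submodule.mem_iSup_of_mem y <| Submodule.mem_iSup_of_mem hy ⟨w, rfl⟩

theorem relations_le {N : Submodule ℂ (Free M₀)} (hbracket : ∀ x y t, bracketDefect x y t ∈ N)
    (htop : ∀ y : Idx M₀, 0 ≤ y.1 → ∀ w, topDefect α β y w ∈ N) : relations M₀ α β ≤ N := by
  refine sup_le (iSup₂_le fun x y => ?_) (iSup₂_le fun y hy => ?_)
  · rintro _ ⟨t, rfl⟩
    exact hbracket x y t
  · rintro _ ⟨w, rfl⟩
    exact htop y hy w

theorem diag_bracketDefect (u x y : Idx M₀) (t : Free M₀) :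
    diag α β u (bracketDefect x y t) = bracketDefect x y (diag α β u t)
      + (val x - val u) • bracketDefect (u + x) y t
      + (val y - val u) • bracketDefect x (u + y) t := by
  simp only [bracketDefect, LinearMap.sub_apply, Module.End.mul_apply, LinearMap.smul_apply,
    map_sub, map_add, map_smul, diag_letter_apply, val_add, add_left_comm x u y, ← add_assoc u x y]
  module

theorem diag_topDefect {u y : Idx M₀} (hu : 0 ≤ u.1) (hy : 0 ≤ y.1) (w : V M₀) :
    diag α β u (topDefect α β y w) = topDefect α β y (act α β (d u) w)
      + (val y - val u) • topDefect α β (u + y) w := by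
  have hact : act α β (d u) (act α β (d y) w) = act α β (d y) (act α β (d u) w)
      + (val y - val u) • act α β (d (u + y)) w := by
    rw [← LinearMap.smul_apply, ← map_smul, ← lie_d, act_lie_d α β u y hu hy]
    simp
  simp only [topDefect, LinearMap.sub_apply, LinearMap.comp_apply, map_sub, diag_letter_apply,
    diag_top, hact, map_add, map_smul]
  module

theorem diag_mem_relations {u : Idx M₀} (hu : 0 ≤ u.1) {t : Free M₀}
    (ht : t ∈ relations M₀ α β) : diag α β u t ∈ relations M₀ α β := by
  suffices relations M₀ α β ≤ (relations M₀ α β).comap (diag α β u) from this ht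
  refine relations_le (fun x y t => ?_) fun y hy w => ?_
  · rw [Submodule.mem_comap, diag_bracketDefect]
    exact add_mem (add_mem (bracketDefect_mem_relations _ _ _)
      (Submodule.smul_mem _ _ (bracketDefect_mem_relations _ _ _)))
      (Submodule.smul_mem _ _ (bracketDefect_mem_relations _ _ _))
  · rw [Submodule.mem_comap, diag_topDefect hu hy]
    exact add_mem (topDefect_mem_relations hy _)
      (Submodule.smul_mem _ _ (topDefect_mem_relations (add_nonneg hu hy) _))

theorem freeProj_bracketDefect_of_nonneg {x : Idx M₀} (hx : 0 ≤ x.1) (y : Idx M₀) (t : Free M₀) :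
    freeProj α β (bracketDefect x y t) = 0 := by
  simp only [bracketDefect, LinearMap.sub_apply, Module.End.mul_apply, LinearMap.smul_apply,
    map_sub, map_add, map_smul, freeProj_letter_of_nonneg hx, diag_letter_apply]
  rcases lt_or_ge y.1 0 with hy | hy
  · simp [freeProj_letter_of_neg hy]
  · have hxy : 0 ≤ (x + y).1 := add_nonneg hx hy
    have hcomm := LinearMap.congr_fun (diag_mul_diag (α := α) (β := β) hx hy) t
    simp only [Module.End.mul_apply, LinearMap.add_apply, LinearMap.smul_apply] at hcomm
    simp only [freeProj_letter_of_nonneg hy, freeProj_letter_of_nonneg hx,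
      freeProj_letter_of_nonneg hxy, diag_letter_apply, map_add, map_smul, hcomm, add_comm y x]
    module

theorem freeProj_bracketDefect (x y : Idx M₀) (t : Free M₀) :
    freeProj α β (bracketDefect x y t) = 0 := by
  rcases le_or_gt 0 x.1 with hx | hx
  · exact freeProj_bracketDefect_of_nonneg hx y t
  rcases le_or_gt 0 y.1 with hy | hy
  · have hskew : bracketDefect x y t = -bracketDefect y x t := by
      simp only [bracketDefect, LinearMap.sub_apply, Module.End.mul_apply, LinearMap.smul_apply,
        add_comm y x]
      module
    rw [hskew, map_neg, freeProj_bracketDefect_of_nonneg hy, neg_zero]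
  · have hxy : (x + y).1 < 0 := add_neg hx hy
    simp [bracketDefect, freeProj_letter_of_neg hx, freeProj_letter_of_neg hy,
      freeProj_letter_of_neg hxy]

theorem freeProj_topDefect {y : Idx M₀} (hy : 0 ≤ y.1) (w : V M₀) :
    freeProj α β (topDefect α β y w) = 0 := by
  rw [topDefect, LinearMap.sub_apply, map_sub, LinearMap.comp_apply, LinearMap.comp_apply,
    freeProj_letter_of_nonneg hy, diag_top, sub_self]

theorem freeProj_word_eq_zero {t : Free M₀} (ht : t ∈ relations M₀ α β) (l : List (Idx M₀)) :
    freeProj α β ((l.map letter).prod t) = 0 := by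
  induction hn : l.length generalizing l t with
  | zero =>
    obtain rfl := List.length_eq_zero_iff.1 hn
    suffices relations M₀ α β ≤ LinearMap.ker (freeProj α β) from this ht
    exact relations_le freeProj_bracketDefect fun y hy => freeProj_topDefect hy
  | succ n ih =>
    obtain ⟨y, l, rfl⟩ := List.exists_cons_of_length_eq_add_one hn
    have hl : l.length = n := Nat.succ_injective hn
    rw [List.map_cons, List.prod_cons, Module.End.mul_apply]
    rcases lt_or_ge y.1 0 with hy | hy
    · exact freeProj_letter_of_neg hy _
    have hdiag := LinearMap.congr_fun
      (mul_prod_map_eq_sum (diag_mul_letter (α := α) (β := β) y) l) t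
    simp only [Module.End.mul_apply, LinearMap.add_apply, LinearMap.sum_apply,
      LinearMap.smul_apply] at hdiag
    rw [freeProj_letter_of_nonneg hy, hdiag, map_add, map_sum,
      ih (diag_mem_relations hy ht) l hl, add_zero]
    refine Finset.sum_eq_zero fun q _ => ?_
    rw [map_smul, ih ht _ (by rw [List.length_modify, hl]), smul_zero]

variable (M₀ α β) in
/-- The largest subspace of `T(L) ⊗ V(α, β)` that is stable under left multiplication and killed by
`freeProj`. It contains all relations, so that `L` acts on the quotient. -/
def freeCore : Submodule ℂ (Free M₀) :=
  ⨅ l : List (Idx M₀), LinearMap.ker (freeProj α β ∘ₗ (l.map letter).prod)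

theorem mem_freeCore {t : Free M₀} :
    t ∈ freeCore M₀ α β ↔ ∀ l : List (Idx M₀), freeProj α β ((l.map letter).prod t) = 0 := by
  simp [freeCore]

theorem relations_le_freeCore : relations M₀ α β ≤ freeCore M₀ α β :=
  fun _ ht => mem_freeCore.2 (freeProj_word_eq_zero ht)

theorem freeCore_le_comap_letter (m : Idx M₀) :
    freeCore M₀ α β ≤ (freeCore M₀ α β).comap (letter m) := fun t ht =>
  mem_freeCore.2 fun l => by simpa using mem_freeCore.1 ht (l ++ [m])

variable (M₀ α β) in
/-- The action of `L` on `T(L) ⊗ V(α, β) / freeCore`. -/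
def modelRep : L M₀ →ₗ⁅ℂ⁆ Module.End ℂ (Free M₀ ⧸ freeCore M₀ α β) :=
  repHom (fun m => (freeCore M₀ α β).mapQ _ (letter m) (freeCore_le_comap_letter m)) fun x y => by
    refine Submodule.linearMap_qext _ (LinearMap.ext fun t => ?_)
    have h := relations_le_freeCore (bracketDefect_mem_relations (α := α) (β := β) x y t)
    rw [← sub_eq_zero]
    convert (Submodule.Quotient.mk_eq_zero _).2 h using 1
    simp only [bracketDefect, LinearMap.comp_apply, LinearMap.sub_apply, LinearMap.add_apply,
      LinearMap.smul_apply, Module.End.mul_apply, Submodule.mkQ_apply, Submodule.mapQ_apply,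
      Submodule.Quotient.mk_sub, Submodule.Quotient.mk_smul]
    abel

theorem exists_proj_Vtilde : ∃ π : Vtilde M₀ α β →ₗ[ℂ] V M₀, (∀ w, π (emb M₀ α β w) = w) ∧
    ∀ m : Idx M₀, m.1 < 0 → ∀ w, π (UniversalEnvelopingAlgebra.ι ℂ (d m) • w) = 0 := by
  let _ : Module (U M₀) (Free M₀ ⧸ freeCore M₀ α β) :=
    Module.compHom _ (UniversalEnvelopingAlgebra.lift ℂ (modelRep M₀ α β)).toRingHom
  have hsmul (m : Idx M₀) (t : Free M₀) : UniversalEnvelopingAlgebra.ι ℂ (d m) •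
      (freeCore M₀ α β).mkQ t = (freeCore M₀ α β).mkQ (letter m t) := by
    change UniversalEnvelopingAlgebra.lift ℂ (modelRep M₀ α β) _ _ = _
    rw [UniversalEnvelopingAlgebra.lift_ι_apply]
    exact LinearMap.congr_fun (ext_d _ m) _
  have _ : IsScalarTower ℂ (U M₀) (Free M₀ ⧸ freeCore M₀ α β) := ⟨fun c u x =>
    LinearMap.congr_fun (map_smul (UniversalEnvelopingAlgebra.lift ℂ (modelRep M₀ α β)) c u) x⟩
  obtain ⟨F, hF⟩ := exists_lift_Vtilde (α := α) (β := β) ((freeCore M₀ α β).mkQ ∘ₗ top)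
    fun m hm w => by
      have h := relations_le_freeCore (topDefect_mem_relations (α := α) (β := β) hm w)
      rw [LinearMap.comp_apply, LinearMap.comp_apply, hsmul]
      exact (Submodule.Quotient.eq _).2 h
  let p : (Free M₀ ⧸ freeCore M₀ α β) →ₗ[ℂ] V M₀ :=
    (freeCore M₀ α β).liftQ (freeProj α β) fun t ht => mem_freeCore.1 ht []
  refine ⟨p ∘ₗ F.restrictScalars ℂ, fun w => ?_, fun m hm w => ?_⟩
  · rw [LinearMap.comp_apply, LinearMap.restrictScalars_apply, hF]
    exact freeProj_top w
  · obtain ⟨t, ht⟩ := (freeCore M₀ α β).mkQ_surjective (F w)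
    rw [LinearMap.comp_apply, LinearMap.restrictScalars_apply, map_smul, ← ht, hsmul]
    exact freeProj_letter_of_neg hm t

end Proj

/-! ### Invariant subspaces and eigenvectors -/

section Spectral

variable {K E κ : Type*} [Field K] [AddCommGroup E] [Module K E] {T : Module.End K E}

theorem mem_span_image_of_mem_eigenspace {e : κ → E} {μ : κ → K}
    (he : ∀ k, e k ∈ T.eigenspace (μ k)) (hspan : Submodule.span K (Set.range e) = ⊤) {x : E}
    {ν : K} (hx : x ∈ T.eigenspace ν) : x ∈ Submodule.span K (e '' {k | μ k = ν}) := by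
  have hle : (fun ν => Submodule.span K (e '' {k | μ k = ν})) ≤ T.eigenspace := fun ν =>
    Submodule.span_le.2 (by rintro _ ⟨k, rfl, rfl⟩; exact he k)
  have htop : ⨆ ν, Submodule.span K (e '' {k | μ k = ν}) = ⊤ := by
    rw [eq_top_iff, ← hspan, Submodule.span_le]
    rintro _ ⟨k, rfl⟩
    exact Submodule.mem_iSup_of_mem (μ k) (Submodule.subset_span ⟨k, rfl, rfl⟩)
  rwa [← (T.eigenspaces_iSupIndep.le_iff_eq_of_iSup_eq_top htop).1 hle] at hx

theorem le_iSup_inf_eigenspace {N : Submodule K E} (hN : N ≤ N.comap T)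
    (htop : ⨆ μ, T.eigenspace μ = ⊤) : N ≤ ⨆ μ, N ⊓ T.eigenspace μ := by
  classical
  intro x hx
  obtain ⟨m, hm, rfl⟩ := (Submodule.mem_iSup_iff_exists_finsupp _ _).1
    (htop ▸ Submodule.mem_top : x ∈ ⨆ μ, T.eigenspace μ)
  -- The images of the components in `E ⧸ N` are eigenvectors with sum zero.
  have hzero := (iSupIndep_iff_finsetSum_eq_zero_imp_eq_zero _).1
    (Module.End.eigenspaces_iSupIndep (N.mapQ N T hN)) m.support (fun μ => N.mkQ (m μ))
    (fun μ _ => by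
      rw [Module.End.mem_eigenspace_iff, Submodule.mkQ_apply, Submodule.mapQ_apply,
        Module.End.mem_eigenspace_iff.1 (hm μ), Submodule.Quotient.mk_smul])
    (by rw [← map_sum]; exact (Submodule.Quotient.mk_eq_zero N).2 hx)
  exact Submodule.sum_mem _ fun μ hμ => Submodule.mem_iSup_of_mem μ
    ⟨(Submodule.Quotient.mk_eq_zero N).1 (hzero μ hμ), hm μ⟩

end Spectral

/-! ### Modules generated by a top level -/

theorem adjoin_range_ι_eq_top (R 𝔤 : Type*) [CommRing R] [LieRing 𝔤] [LieAlgebra R 𝔤] :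
    Algebra.adjoin R (Set.range (UniversalEnvelopingAlgebra.ι R : 𝔤 → _)) = ⊤ := by
  set S := Algebra.adjoin R (Set.range (UniversalEnvelopingAlgebra.ι R : 𝔤 → _))
  let f : 𝔤 →ₗ⁅R⁆ S :=
    { toFun := fun x => ⟨UniversalEnvelopingAlgebra.ι R x, Algebra.subset_adjoin ⟨x, rfl⟩⟩
      map_add' := fun x y => Subtype.ext (map_add _ x y)
      map_smul' := fun c x => Subtype.ext (map_smul _ c x)
      map_lie' := fun {x y} => Subtype.ext (LieHom.map_lie _ x y) }
  have hf : S.val.comp (UniversalEnvelopingAlgebra.lift R f) = AlgHom.id R _ :=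
    UniversalEnvelopingAlgebra.hom_ext R (LieHom.ext fun x => by
      simp [f])
  refine eq_top_iff.2 fun u _ => ?_
  rw [← AlgHom.id_apply (R := R) u, ← hf]
  exact (UniversalEnvelopingAlgebra.lift R f u).2

section Modules

variable {M₀ : AddSubgroup ℂ} (E : Type*) [AddCommGroup E] [Module ℂ E] [Module (U M₀) E]
  [IsScalarTower ℂ (U M₀) E]

/-- The operator of `d m` on an `L`-module. -/
def opr (m : Idx M₀) : Module.End ℂ E :=
  Algebra.lsmul ℂ ℂ E (UniversalEnvelopingAlgebra.ι ℂ (d m) : U M₀)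

variable {E}

theorem opr_mul_opr (m n : Idx M₀) :
    opr E m * opr E n = opr E n * opr E m + (val n - val m) • opr E (m + n) := by
  have h := (UniversalEnvelopingAlgebra.ι ℂ (L := L M₀)).map_lie (d m) (d n)
  rw [lie_d, map_smul, LieRing.of_associative_ring_bracket] at h
  simp only [opr, ← map_smul, ← map_mul, ← map_add, h, add_sub_cancel]

theorem opr_opr_apply (m n : Idx M₀) (w : E) :
    opr E m (opr E n w) = opr E n (opr E m w) + (val n - val m) • opr E (m + n) w :=
  LinearMap.congr_fun (opr_mul_opr m n) w

theorem smul_mem_of_opr {S : Submodule ℂ E} (hS : ∀ m : Idx M₀, S ≤ S.comap (opr E m))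
    (u : U M₀) {w : E} (hw : w ∈ S) : u • w ∈ S := by
  have hu : u ∈ Algebra.adjoin ℂ (Set.range (UniversalEnvelopingAlgebra.ι ℂ : L M₀ → _)) :=
    adjoin_range_ι_eq_top ℂ (L M₀) ▸ Algebra.mem_top
  induction hu using Algebra.adjoin_induction generalizing w with
  | mem _ h =>
    obtain ⟨x, rfl⟩ := h
    induction x using induction_d with
    | h0 => simp
    | hadd x y hx hy => rw [map_add, add_smul]; exact add_mem hx hy
    | hsmul c x hx => rw [map_smul, smul_assoc]; exact S.smul_mem c hx
    | hd m => exact hS m hw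
  | algebraMap c => rw [algebraMap_smul]; exact S.smul_mem c hw
  | add a b _ _ ha hb => rw [add_smul]; exact add_mem (ha hw) (hb hw)
  | mul a b _ _ ha hb => rw [mul_smul]; exact ha (hb hw)

/-- The `L`-module `E` is generated by a copy `e` of the `L₊ + L₀`-module `V(α, β)`, on which it
projects by `π` with the products starting with some `d m` of negative level projecting to zero. -/
structure IsTopLevel (α β : ℂ) (e : V M₀ →ₗ[ℂ] E) (π : E →ₗ[ℂ] V M₀) : Prop where
  opr_top : ∀ m : Idx M₀, 0 ≤ m.1 → ∀ w, opr E m (e w) = e (act α β (d m) w)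
  span_top : Submodule.span (U M₀) (Set.range e) = ⊤
  proj_top : ∀ w, π (e w) = w
  proj_neg : ∀ m : Idx M₀, m.1 < 0 → ∀ x, π (opr E m x) = 0

/-- The words `d_{m_1} ⋯ d_{m_k} v_b` with all letters of negative level. -/
abbrev NegWord (M₀ : AddSubgroup ℂ) : Type := {l : List (Idx M₀) // ∀ m ∈ l, m.1 < 0} × M₀

/-- The index in `M` of the weight of a word, relative to `α`. -/
def NegWord.idx (k : NegWord M₀) : Idx M₀ := k.1.1.sum + (0, k.2)

/-- The vector of an `L`-module given by a word. -/
def NegWord.vec (e : V M₀ →ₗ[ℂ] E) (k : NegWord M₀) : E := (k.1.1.map (opr E)).prod (e (v k.2))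

theorem NegWord.length_le_neg_idx (k : NegWord M₀) : (k.1.1.length : ℤ) ≤ -k.idx.1 := by
  obtain ⟨⟨l, hl⟩, b⟩ := k
  simp only [NegWord.idx, Prod.fst_add, add_zero]
  induction l with
  | nil => simp
  | cons m l ih =>
    have hm := hl m List.mem_cons_self
    have hl' := ih fun n hn => hl n (List.mem_cons_of_mem m hn)
    rw [List.sum_cons, Prod.fst_add, List.length_cons]
    omega

/-- The space of vectors of weight `n + α`. -/
def weightSpace (E : Type*) [AddCommGroup E] [Module ℂ E] [Module (U M₀) E]
    [IsScalarTower ℂ (U M₀) E] (α : ℂ) (n : Idx M₀) : Submodule ℂ E :=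
  (opr E (0 : Idx M₀)).eigenspace (val n + α)

theorem opr_mem_weightSpace {α : ℂ} {n : Idx M₀} (m : Idx M₀) {w : E}
    (hw : w ∈ weightSpace E α n) : opr E m w ∈ weightSpace E α (m + n) := by
  rw [weightSpace, Module.End.mem_eigenspace_iff] at hw ⊢
  rw [opr_opr_apply, hw, map_smul, zero_add, ← add_smul, val_add]
  congr 1
  simp only [val, Prod.fst_zero, Prod.snd_zero, Int.cast_zero, ZeroMemClass.coe_zero]
  ring

namespace IsTopLevel

variable {α β : ℂ} {e : V M₀ →ₗ[ℂ] E} {π : E →ₗ[ℂ] V M₀}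

theorem vec_mem_weightSpace (h : IsTopLevel α β e π) (k : NegWord M₀) :
    k.vec e ∈ weightSpace E α k.idx := by
  obtain ⟨⟨l, hl⟩, b⟩ := k
  simp only [NegWord.idx, NegWord.vec]
  clear hl
  induction l with
  | nil =>
    rw [weightSpace, Module.End.mem_eigenspace_iff]
    have h0 : act α β (d (0 : Idx M₀)) (v b) = ((b : ℂ) + α) • v b :=
      (act_d α β 0 b).trans (by simp)
    rw [List.map_nil, List.prod_nil, Module.End.one_apply, h.opr_top 0 le_rfl, h0, map_smul]
    simp [val]
  | cons m l ih =>
    rw [List.sum_cons, add_assoc, List.map_cons, List.prod_cons]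
    exact opr_mem_weightSpace m ih

theorem span_vec (h : IsTopLevel α β e π) :
    Submodule.span ℂ (Set.range (NegWord.vec e)) = ⊤ := by
  set S := Submodule.span ℂ (Set.range (NegWord.vec e))
  have hword (l : List (Idx M₀)) (hl : ∀ m ∈ l, m.1 < 0) (w : V M₀) :
      (l.map (opr E)).prod (e w) ∈ S := by
    suffices S.mkQ ∘ₗ (l.map (opr E)).prod ∘ₗ e = 0 from
      (Submodule.Quotient.mk_eq_zero S).1 (LinearMap.congr_fun this w)
    exact homV_ext fun b =>
      (Submodule.Quotient.mk_eq_zero S).2 (Submodule.subset_span ⟨(⟨l, hl⟩, b), rfl⟩)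
  have hneg (m : Idx M₀) (hm : m.1 < 0) : S ≤ S.comap (opr E m) := by
    refine Submodule.span_le.2 ?_
    rintro _ ⟨⟨⟨l, hl⟩, b⟩, rfl⟩
    exact hword (m :: l) (by simpa [hm] using hl) (v b)
  have hopr (m : Idx M₀) : S ≤ S.comap (opr E m) := by
    refine Submodule.span_le.2 ?_
    rintro _ ⟨⟨⟨l, hl⟩, b⟩, rfl⟩
    rw [SetLike.mem_coe, Submodule.mem_comap, NegWord.vec]
    induction l generalizing m with
    | nil =>
      rcases lt_or_ge m.1 0 with hm | hm
      · exact hneg m hm (hword [] (by simp) _)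
      · rw [List.map_nil, List.prod_nil, Module.End.one_apply, h.opr_top m hm]
        exact hword [] (by simp) _
    | cons n l ih =>
      rw [List.forall_mem_cons] at hl
      rw [List.map_cons, List.prod_cons, Module.End.mul_apply, opr_opr_apply]
      exact add_mem (hneg n hl.1 (ih m hl.2)) (S.smul_mem _ (ih _ hl.2))
  let S' : Submodule (U M₀) E := { S with smul_mem' := fun u _ => smul_mem_of_opr hopr u }
  have hS' : S' = ⊤ := by
    rw [eq_top_iff, ← h.span_top, Submodule.span_le]
    rintro _ ⟨w, rfl⟩
    exact hword [] (by simp) w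
  exact eq_top_iff.2 fun x _ => (hS' ▸ Submodule.mem_top : x ∈ S')

theorem mem_span_vec (h : IsTopLevel α β e π) {z : ℂ} {x : E}
    (hx : x ∈ (opr E (0 : Idx M₀)).eigenspace z) :
    x ∈ Submodule.span ℂ (NegWord.vec e '' {k | val k.idx + α = z}) :=
  mem_span_image_of_mem_eigenspace h.vec_mem_weightSpace h.span_vec hx

theorem proj_opr (h : IsTopLevel α β e π) {m : Idx M₀} (hm : m.1 = 0) (x : E) :
    π (opr E m x) = act α β (d m) (π x) := by
  suffices π ∘ₗ opr E m = act α β (d m) ∘ₗ π from LinearMap.congr_fun this x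
  refine LinearMap.ext_on_range h.span_vec ?_
  rintro ⟨⟨l, hl⟩, b⟩
  rw [LinearMap.comp_apply, LinearMap.comp_apply, NegWord.vec]
  cases l with
  | nil => simp [h.opr_top m hm.ge, h.proj_top]
  | cons n l =>
    have hn : n.1 < 0 := hl n List.mem_cons_self
    have hmn : (m + n).1 < 0 := by rwa [Prod.fst_add, hm, zero_add]
    rw [List.map_cons, List.prod_cons, Module.End.mul_apply, opr_opr_apply, map_add, map_smul,
      h.proj_neg n hn, h.proj_neg n hn, h.proj_neg _ hmn, smul_zero, add_zero, map_zero]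

theorem proj_word (h : IsTopLevel α β e π) (l : List (Idx M₀)) (w : V M₀) :
    π ((l.map (opr E)).prod (e w)) = extV (topCoef α β l) w := by
  induction hn : l.length generalizing l w with
  | zero =>
    obtain rfl := List.length_eq_zero_iff.1 hn
    have hid : extV (topCoef α β []) = LinearMap.id (M := V M₀) :=
      homV_ext fun b => by rw [extV_v, topCoef_nil, LinearMap.id_apply]
    rw [hid, List.map_nil, List.prod_nil, Module.End.one_apply, h.proj_top, LinearMap.id_apply]
  | succ n ih =>
    obtain ⟨y, l, rfl⟩ := List.exists_cons_of_length_eq_add_one hn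
    have hl : l.length = n := Nat.succ_injective hn
    suffices π ∘ₗ ((y :: l).map (opr E)).prod ∘ₗ e = extV (topCoef α β (y :: l)) from
      LinearMap.congr_fun this w
    refine homV_ext fun b => ?_
    rw [LinearMap.comp_apply, LinearMap.comp_apply, List.map_cons, List.prod_cons, extV_v]
    rcases lt_or_ge y.1 0 with hy | hy
    · rw [topCoef_cons_of_neg hy]
      exact h.proj_neg y hy _
    rw [mul_prod_map_eq_sum (opr_mul_opr (E := E) y) l, LinearMap.add_apply, LinearMap.sum_apply,
      Module.End.mul_apply, h.opr_top y hy, map_add, map_sum, ih l _ hl, topCoef_cons_of_nonneg hy]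
    congr 1
    refine Finset.sum_congr rfl fun q _ => ?_
    rw [LinearMap.smul_apply, map_smul, ih _ _ (by rw [List.length_modify, hl]), extV_v]

theorem top_proj_of_mem_weightSpace (h : IsTopLevel α β e π)
    (hval : Function.Injective (val : Idx M₀ → ℂ)) {b : M₀} {x : E}
    (hx : x ∈ weightSpace E α (0, b)) : e (π x) = x := by
  suffices Submodule.span ℂ (NegWord.vec e '' {k | val k.idx + α = val (0, b) + α}) ≤
    LinearMap.eqLocus (e ∘ₗ π) LinearMap.id from this (h.mem_span_vec hx)
  refine Submodule.span_le.2 ?_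
  rintro _ ⟨⟨⟨l, hl⟩, c⟩, hk, rfl⟩
  have hlen := NegWord.length_le_neg_idx ⟨⟨l, hl⟩, c⟩
  rw [hval (add_right_cancel hk)] at hlen
  obtain rfl : l = [] := List.length_eq_zero_iff.1 (by simpa using hlen)
  simp [NegWord.vec, h.proj_top]

theorem proj_eq_zero_of_mem_eigenspace (h : IsTopLevel α β e π) {z : ℂ}
    (hz : ∀ b : M₀, val (0, b) + α ≠ z) {x : E} (hx : x ∈ (opr E (0 : Idx M₀)).eigenspace z) :
    π x = 0 := by
  suffices Submodule.span ℂ (NegWord.vec e '' {k | val k.idx + α = z}) ≤ LinearMap.ker π from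
    this (h.mem_span_vec hx)
  refine Submodule.span_le.2 ?_
  rintro _ ⟨⟨⟨l, hl⟩, b⟩, hk, rfl⟩
  cases l with
  | nil => exact absurd (by simpa [NegWord.idx] using hk) (hz b)
  | cons m l => exact h.proj_neg m (hl m List.mem_cons_self) _

theorem top_proj_mem (h : IsTopLevel α β e π) (hval : Function.Injective (val : Idx M₀ → ℂ))
    (N : Submodule (U M₀) E) {x : E} (hx : x ∈ N) : e (π x) ∈ N := by
  have htop : ⨆ z, (opr E (0 : Idx M₀)).eigenspace z = ⊤ := by
    rw [eq_top_iff, ← h.span_vec, Submodule.span_le]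
    rintro _ ⟨k, rfl⟩
    exact Submodule.mem_iSup_of_mem _ (h.vec_mem_weightSpace k)
  suffices N.restrictScalars ℂ ≤ (N.restrictScalars ℂ).comap (e ∘ₗ π) from this hx
  refine (le_iSup_inf_eigenspace (T := opr E (0 : Idx M₀)) (fun y hy => N.smul_mem _ hy) htop).trans
    (iSup_le fun z => ?_)
  rintro y ⟨hyN, hy⟩
  rw [Submodule.mem_comap, LinearMap.comp_apply]
  by_cases hz : ∃ b : M₀, val (0, b) + α = z
  · obtain ⟨b, rfl⟩ := hz
    rwa [h.top_proj_of_mem_weightSpace hval hy]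
  · rw [h.proj_eq_zero_of_mem_eigenspace (not_exists.1 hz) hy, map_zero]
    exact Submodule.zero_mem _

end IsTopLevel

end Modules

/-! ### The quotient by the largest submodule avoiding the top level -/

theorem val_injective {M₀ : AddSubgroup ℂ}
    (hdisj : Disjoint (AddSubgroup.zmultiples (1 : ℂ)) M₀) :
    Function.Injective (val : Idx M₀ → ℂ) := by
  let f : Idx M₀ →+ ℂ := AddMonoidHom.mk' val val_add
  refine (injective_iff_map_eq_zero f).2 ?_
  rintro ⟨i, a⟩ h
  have hia : (i : ℂ) = ((-a : M₀) : ℂ) := by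
    rw [AddSubgroup.coe_neg]; exact eq_neg_of_add_eq_zero_left h
  have hi : (i : ℂ) = 0 := AddSubgroup.disjoint_def.1 hdisj
    (AddSubgroup.mem_zmultiples_iff.2 ⟨i, zsmul_one i⟩) (hia ▸ (-a).2)
  have ha : -a = 0 := Subtype.ext (hia.symm.trans hi)
  exact Prod.ext (Int.cast_eq_zero.1 hi) (neg_eq_zero.1 ha)

section Quotient

variable {M₀ : AddSubgroup ℂ} {α β : ℂ}

theorem exists_isTopLevel_Vtilde :
    ∃ π : Vtilde M₀ α β →ₗ[ℂ] V M₀, IsTopLevel α β (emb M₀ α β) π := by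
  obtain ⟨π, hπ, hneg⟩ := exists_proj_Vtilde (α := α) (β := β)
  refine ⟨π, fun m hm w => d_smul_emb hm w, ?_, hπ, hneg⟩
  refine eq_top_iff.2 fun x _ => ?_
  obtain ⟨t, rfl⟩ := Submodule.mkQ_surjective _ x
  induction t using TensorProduct.induction_on with
  | zero => rw [map_zero]; exact Submodule.zero_mem _
  | add x y hx hy => rw [map_add]; exact Submodule.add_mem _ (hx trivial) (hy trivial)
  | tmul u w =>
    have huw : u ⊗ₜ[ℂ] w = u • ((1 : U M₀) ⊗ₜ[ℂ] w) := by
      rw [TensorProduct.smul_tmul', smul_eq_mul, mul_one]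
    rw [huw, map_smul]
    exact Submodule.smul_mem _ u (Submodule.subset_span ⟨w, rfl⟩)

namespace IsTopLevel

theorem mem_J_iff {π : Vtilde M₀ α β →ₗ[ℂ] V M₀} (h : IsTopLevel α β (emb M₀ α β) π)
    (hval : Function.Injective (val : Idx M₀ → ℂ)) (x : Vtilde M₀ α β) :
    x ∈ J M₀ α β ↔ ∀ u : U M₀, π (u • x) = 0 := by
  let K : Submodule (U M₀) (Vtilde M₀ α β) :=
    { carrier := {x | ∀ u : U M₀, π (u • x) = 0}
      zero_mem' := fun u => by rw [smul_zero, map_zero]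
      add_mem' := fun hx hy u => by rw [smul_add, map_add, hx u, hy u, add_zero]
      smul_mem' := fun c x hx u => by rw [smul_smul]; exact hx _ }
  suffices J M₀ α β = K by rw [this]; rfl
  refine le_antisymm (sSup_le fun N hN x hx u => ?_) (le_sSup ?_)
  · have hmem : emb M₀ α β (π (u • x)) ∈
        N.restrictScalars ℂ ⊓ LinearMap.range (emb M₀ α β) :=
      ⟨h.top_proj_mem hval N (N.smul_mem u hx), LinearMap.mem_range_self _ _⟩
    rw [(hN : _ = ⊥), Submodule.mem_bot] at hmem
    rw [← h.proj_top (π (u • x)), hmem, map_zero]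
  · refine (Submodule.eq_bot_iff _).2 ?_
    rintro _ ⟨hx, w, rfl⟩
    have hw : π ((1 : U M₀) • emb M₀ α β w) = 0 := hx 1
    rw [one_smul, h.proj_top] at hw
    rw [hw, map_zero]

end IsTopLevel

theorem exists_isTopLevel_Vbar (hval : Function.Injective (val : Idx M₀ → ℂ)) :
    ∃ (e : V M₀ →ₗ[ℂ] Vbar M₀ α β) (π : Vbar M₀ α β →ₗ[ℂ] V M₀), IsTopLevel α β e π ∧
      ∀ w, (∀ u : U M₀, π (u • w) = 0) → w = 0 := by
  obtain ⟨π, h⟩ := exists_isTopLevel_Vtilde (α := α) (β := β)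
  have hJ := h.mem_J_iff hval
  set q := (J M₀ α β).mkQ
  have hq : Function.Surjective q := Submodule.mkQ_surjective _
  have hker : (J M₀ α β).restrictScalars ℂ ≤ LinearMap.ker π := fun x hx => by
    simpa only [LinearMap.mem_ker, one_smul] using (hJ x).1 hx 1
  let ϖ : Vbar M₀ α β →ₗ[ℂ] V M₀ := ((J M₀ α β).restrictScalars ℂ).liftQ π hker ∘ₗ
    (Submodule.Quotient.restrictScalarsEquiv ℂ (J M₀ α β)).symm.toLinearMap
  refine ⟨q.restrictScalars ℂ ∘ₗ emb M₀ α β, ϖ, ⟨fun m hm w => ?_, ?_, h.proj_top, ?_⟩, ?_⟩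
  · exact congrArg q (h.opr_top m hm w)
  · have hspan := congrArg (Submodule.map q) h.span_top
    rwa [Submodule.map_span, Submodule.map_top, Submodule.range_mkQ, ← Set.range_comp] at hspan
  · intro m hm w
    obtain ⟨x, rfl⟩ := hq w
    exact h.proj_neg m hm x
  · intro w hw
    obtain ⟨x, rfl⟩ := hq w
    exact (Submodule.Quotient.mk_eq_zero _).2 ((hJ x).2 hw)

theorem wt_eq_weightSpace (i : ℕ) (a : M₀) :
    wt M₀ α β (-(i : ℂ) + α + a) = weightSpace (Vbar M₀ α β) α ((-i, a) : Idx M₀) := by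
  have hval : val ((-i, a) : Idx M₀) + α = -(i : ℂ) + α + a := by
    simp only [val, Int.cast_neg, Int.cast_natCast]
    ring
  ext w
  rw [weightSpace, hval, Module.End.mem_eigenspace_iff]
  rfl

end Quotient

/-! ### Vectors seen from the top level through `L₁` -/

section LevelOne

variable {M₀ : AddSubgroup ℂ} {E : Type*} [AddCommGroup E] [Module ℂ E] [Module (U M₀) E]
  [IsScalarTower ℂ (U M₀) E]

variable (E) in
/-- The product `d_{1+c_1} ⋯ d_{1+c_k}` of elements of `L₁`, as an operator. -/
def levelOneWord (c : List M₀) : Module.End ℂ E := (c.map fun a => opr E ((1, a) : Idx M₀)).prod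

theorem levelOneWord_concat (c : List M₀) (a : M₀) :
    levelOneWord E (c ++ [a]) = levelOneWord E c * opr E ((1, a) : Idx M₀) := by
  simp [levelOneWord]

theorem levelOneWord_mem_weightSpace {α : ℂ} {n : Idx M₀} (c : List M₀) {w : E}
    (hw : w ∈ weightSpace E α n) :
    levelOneWord E c w ∈ weightSpace E α (((c.length : ℤ), c.sum) + n) := by
  induction c with
  | nil => simpa [levelOneWord, ← Prod.zero_eq_mk] using hw
  | cons a c ih =>
    rw [List.sum_cons, List.length_cons, Nat.cast_succ, add_comm _ (1 : ℤ), ← Prod.mk_add_mk,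
      add_assoc]
    exact opr_mem_weightSpace _ ih

theorem opr_mul_levelOneWord (x : M₀) (c : List M₀) :
    opr E ((0, x) : Idx M₀) * levelOneWord E c =
      ∑ q ∈ Finset.range c.length,
        (1 + (c.getD q 0 : ℂ) - x) • levelOneWord E (c.modify q (x + ·)) +
      levelOneWord E c * opr E ((0, x) : Idx M₀) := by
  refine mul_prod_map_eq_sum (y := x) (φ := fun a : M₀ => 1 + (a : ℂ) - x) (fun a => ?_) c
  rw [opr_mul_opr, Prod.mk_add_mk, zero_add]
  simp [val]

/-- The vectors whose images under all products of elements of `L₁` project to zero. -/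
def levelOneKer (π : E →ₗ[ℂ] V M₀) : Submodule ℂ E :=
  ⨅ c : List M₀, LinearMap.ker (π ∘ₗ levelOneWord E c)

variable {π : E →ₗ[ℂ] V M₀}

theorem mem_levelOneKer {w : E} :
    w ∈ levelOneKer π ↔ ∀ c : List M₀, π (levelOneWord E c w) = 0 := by
  simp [levelOneKer]

/-- `L₁` generates `L₊`, because `[d_{1+b}, d_{n+a-b}]` is a non-zero multiple of `d_{n+1+a}` for
some `b`. -/
theorem le_comap_opr_of_pos (hM₀ : M₀ ≠ ⊥) {S : Submodule ℂ E}
    (hS : ∀ c : M₀, S ≤ S.comap (opr E ((1, c) : Idx M₀))) {n : ℤ} (hn : 1 ≤ n) (a : M₀) :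
    S ≤ S.comap (opr E ((n, a) : Idx M₀)) := by
  induction n, hn using Int.leInduction generalizing a with
  | base => exact hS a
  | succ n _ ih =>
    obtain ⟨b, hb⟩ : ∃ b : M₀, val ((n, a - b) : Idx M₀) - val ((1, b) : Idx M₀) ≠ 0 := by
      by_contra! hall
      refine hM₀ ((AddSubgroup.eq_bot_iff_forall _).2 fun x hx => ?_)
      have h₀ := hall 0
      have hx := hall ⟨x, hx⟩
      simp only [val, AddSubgroup.coe_sub, AddSubgroup.coe_zero] at h₀ hx
      linear_combination (h₀ - hx) / 2
    intro w hw
    have hcomm := opr_opr_apply (1, b) (n, a - b) w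
    rw [Prod.mk_add_mk, add_comm 1 n, add_sub_cancel, ← sub_eq_iff_eq_add'] at hcomm
    refine (S.smul_mem_iff hb).1 ?_
    rw [← hcomm]
    exact sub_mem (hS b (ih _ hw)) (ih _ (hS b hw))

namespace IsTopLevel

variable {α β : ℂ} {e : V M₀ →ₗ[ℂ] E}

theorem levelOneKer_le_comap_opr (h : IsTopLevel α β e π) (hM₀ : M₀ ≠ ⊥) (m : Idx M₀) :
    levelOneKer π ≤ (levelOneKer π).comap (opr E m) := by
  have hone (a : M₀) : levelOneKer π ≤ (levelOneKer π).comap (opr E ((1, a) : Idx M₀)) := by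
    refine fun w hw => mem_levelOneKer.2 fun c => ?_
    rw [← Module.End.mul_apply, ← levelOneWord_concat]
    exact mem_levelOneKer.1 hw _
  rcases lt_or_ge 0 m.1 with hm | hm
  · exact le_comap_opr_of_pos hM₀ hone hm m.2
  refine fun w hw => mem_levelOneKer.2 fun c => ?_
  induction c using List.reverseRecOn generalizing m w with
  | nil =>
    have hπw : π w = 0 := mem_levelOneKer.1 hw []
    change π (opr E m w) = 0
    rcases hm.lt_or_eq with hm | hm
    · exact h.proj_neg m hm w
    · rw [h.proj_opr hm, hπw, map_zero]
  | append_singleton c a ih =>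
    rw [levelOneWord_concat, Module.End.mul_apply, opr_opr_apply, map_add, map_smul, map_add,
      map_smul, ih m hm _ (hone a hw), zero_add]
    rcases hm.lt_or_eq with hm | hm
    · rw [ih _ (by simp only [Prod.fst_add]; omega) _ hw, smul_zero]
    · obtain ⟨k, b⟩ := m
      obtain rfl : k = 0 := hm
      rw [Prod.mk_add_mk, add_zero, mem_levelOneKer.1 (hone _ hw), smul_zero]

theorem levelOneKer_eq_bot (h : IsTopLevel α β e π) (hM₀ : M₀ ≠ ⊥)
    (hfaith : ∀ w, (∀ u : U M₀, π (u • w) = 0) → w = 0) : levelOneKer π = ⊥ :=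
  (Submodule.eq_bot_iff _).2 fun w hw => hfaith w fun u =>
    mem_levelOneKer.1 (smul_mem_of_opr (h.levelOneKer_le_comap_opr hM₀) u hw) []

theorem proj_levelOneWord_eq_zero (h : IsTopLevel α β e π)
    (hval : Function.Injective (val : Idx M₀ → ℂ)) {i : ℕ} {s : M₀} {w : E}
    (hw : w ∈ weightSpace E α (-i, s)) {c : List M₀} (hc : c.length ≠ i) :
    π (levelOneWord E c w) = 0 := by
  refine h.proj_eq_zero_of_mem_eigenspace (fun b hb => hc ?_) (levelOneWord_mem_weightSpace c hw)
  have hlevel := congrArg Prod.fst (hval (add_right_cancel hb))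
  simp only [Prod.fst_add] at hlevel
  omega

end IsTopLevel

end LevelOne

/-! ### Weight spaces as spaces of polynomials -/

section Polynomials

open MvPolynomial

theorem modify_ofFn {G : Type*} [AddCommMonoid G] {i : ℕ} (c : Fin i → G) (j : Fin i) (x : G) :
    (List.ofFn c).modify j (x + ·) = List.ofFn (c + Pi.single j x) := by
  refine List.ext_getElem (by simp) fun n h₁ h₂ => ?_
  have hn : n < i := by simpa using h₂
  rw [List.getElem_modify, List.getElem_ofFn, List.getElem_ofFn, Pi.add_apply]
  by_cases h : j = ⟨n, hn⟩
  · subst h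
    rw [if_pos rfl, Pi.single_eq_same, add_comm]
  · rw [if_neg fun hj => h (Fin.ext hj), Pi.single_eq_of_ne (Ne.symm h), add_zero]

/-- The polynomial in `x_1, …, x_i` giving the scalar of `d_{1+x_1} ⋯ d_{1+x_i} d_{m_1} ⋯ d_{m_k}`
on `v_b`, where `l` is the list of the `m_j`. -/
def wordPoly {M₀ : AddSubgroup ℂ} (α β : ℂ) (i : ℕ) (l : List (Idx M₀)) (b : M₀) :
    MvPolynomial (Fin i) ℂ :=
  coef (C α) (C β) ((List.ofFn fun j => (1, X j)) ++ l.map fun m => (m.1, C (m.2 : ℂ))) (C (b : ℂ))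

theorem eval_wordPoly {M₀ : AddSubgroup ℂ} (α β : ℂ) {i : ℕ} (l : List (Idx M₀)) (b : M₀)
    (x : Fin i → ℂ) : eval x (wordPoly α β i l b) =
      coef α β ((List.ofFn fun j => (1, x j)) ++ l.map (coords M₀)) b := by
  have hX : (List.ofFn fun j => ((1 : ℤ), (X j : MvPolynomial (Fin i) ℂ))).map
      ((AddMonoidHom.id ℤ).prodMap (eval x)) = List.ofFn fun j => (1, x j) := by
    simp [List.map_ofFn, Function.comp_def]
  have hC : (l.map fun m => (m.1, (C (m.2 : ℂ) : MvPolynomial (Fin i) ℂ))).map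
      ((AddMonoidHom.id ℤ).prodMap (eval x)) = l.map (coords M₀) := by
    simp [Function.comp_def, coords_apply]
  rw [wordPoly, map_coef, eval_C, eval_C, eval_C, List.map_append, hX, hC]

theorem totalDegree_wordPoly_le {M₀ : AddSubgroup ℂ} (α β : ℂ) (i : ℕ) (l : List (Idx M₀))
    (b : M₀) : (wordPoly α β i l b).totalDegree ≤ i + l.length := by
  refine (totalDegree_coef_le α β _ _ ?_ (by simp)).trans_eq (by simp)
  intro y hy
  rcases List.mem_append.1 hy with hy | hy
  · obtain ⟨j, rfl⟩ := List.mem_ofFn.1 hy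
    simp
  · obtain ⟨m, -, rfl⟩ := List.mem_map.1 hy
    simp

variable {M₀ : AddSubgroup ℂ} {E : Type*} [AddCommGroup E] [Module ℂ E] [Module (U M₀) E]
  [IsScalarTower ℂ (U M₀) E] {α β : ℂ} {e : V M₀ →ₗ[ℂ] E} {π : E →ₗ[ℂ] V M₀} {i : ℕ} {s : M₀}

/-- The polynomial `q` describes the vector `w` of weight `-i + s + α`: its values are the
coefficients of `d_{1+c_1} ⋯ d_{1+c_i} w` on the top level. -/
def Describes (π : E →ₗ[ℂ] V M₀) (s : M₀) (w : E) (q : MvPolynomial (Fin i) ℂ) : Prop :=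
  ∀ c : Fin i → M₀,
    π (levelOneWord E (List.ofFn c) w) = eval (fun j => (c j : ℂ)) q • v (s + ∑ j, c j)

namespace Describes

theorem zero : Describes π s 0 (0 : MvPolynomial (Fin i) ℂ) := fun c => by simp

theorem add {w w' : E} {q q' : MvPolynomial (Fin i) ℂ} (h : Describes π s w q)
    (h' : Describes π s w' q') : Describes π s (w + w') (q + q') := fun c => by
  rw [map_add, map_add, h c, h' c, map_add, add_smul]

theorem smul (a : ℂ) {w : E} {q : MvPolynomial (Fin i) ℂ} (h : Describes π s w q) :
    Describes π s (a • w) (a • q) := fun c => by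
  rw [map_smul, map_smul, h c, smul_eval, mul_smul]

theorem proj_modify {w : E} {q : MvPolynomial (Fin i) ℂ} (h : Describes π s w q) (c : Fin i → M₀)
    (j : Fin i) (x : M₀) : π (levelOneWord E ((List.ofFn c).modify j (x + ·)) w) =
      eval ((fun j => (c j : ℂ)) + Pi.single j (x : ℂ)) q • v (x + s + ∑ j, c j) := by
  have hcoe : (fun k => ((c + Pi.single j x : Fin i → M₀) k : ℂ)) =
      (fun j => (c j : ℂ)) + Pi.single j (x : ℂ) := by
    funext k
    by_cases hk : k = j
    · subst hk; simp
    · simp [Pi.single_eq_of_ne hk]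
  have hsum : s + ∑ k, (c + Pi.single j x : Fin i → M₀) k = x + s + ∑ k, c k := by
    simp only [Pi.add_apply, Finset.sum_add_distrib, Finset.sum_pi_single', Finset.mem_univ,
      if_true]
    abel
  rw [modify_ofFn, h, hcoe, hsum]

theorem unique [Infinite M₀] {w : E} {q q' : MvPolynomial (Fin i) ℂ} (h : Describes π s w q)
    (h' : Describes π s w q') : q = q' := by
  refine funext_set (fun _ => (M₀ : Set ℂ)) (fun _ => Set.infinite_coe_iff.1 ‹_›) fun x hx => ?_
  have hv (b : M₀) : (v b : V M₀) ≠ 0 := Finsupp.single_ne_zero.2 one_ne_zero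
  let c (j : Fin i) : M₀ := ⟨x j, hx j trivial⟩
  exact smul_left_injective ℂ (hv _) ((h c).symm.trans (h' c))

end Describes

namespace IsTopLevel

theorem describes_vec (h : IsTopLevel α β e π) {k : NegWord M₀} (hk : k.idx = (-(i : ℤ), s)) :
    Describes π s (k.vec e) (wordPoly α β i k.1.1 k.2) := by
  intro c
  have hword : levelOneWord E (List.ofFn c) (k.vec e) =
      (((List.ofFn fun j => ((1, c j) : Idx M₀)) ++ k.1.1).map (opr E)).prod (e (v k.2)) := by
    simp [levelOneWord, NegWord.vec, List.map_ofFn, Function.comp_def]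
  have hsum : ((List.ofFn fun j => ((1, c j) : Idx M₀)) ++ k.1.1).sum.2 + k.2 =
      s + ∑ j, c j := by
    have hs : k.1.1.sum.2 + k.2 = s := congrArg Prod.snd hk
    rw [List.sum_append, List.sum_ofFn, Prod.snd_add, Prod.snd_sum, add_assoc, hs, add_comm]
  have hcoords : (List.ofFn fun j => ((1, c j) : Idx M₀)).map (coords M₀) =
      List.ofFn fun j => (1, (c j : ℂ)) := by
    simp [List.map_ofFn, Function.comp_def, coords_apply]
  rw [hword, h.proj_word, extV_v, topCoef, hsum, eval_wordPoly, List.map_append, hcoords]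

theorem exists_describes (h : IsTopLevel α β e π) (hval : Function.Injective (val : Idx M₀ → ℂ))
    {w : E} (hw : w ∈ weightSpace E α (-i, s)) :
    ∃ q : MvPolynomial (Fin i) ℂ, q.totalDegree ≤ 2 * i ∧ Describes π s w q := by
  have hmem := h.mem_span_vec hw
  clear hw
  induction hmem using Submodule.span_induction with
  | mem _ hk =>
    obtain ⟨k, hk, rfl⟩ := hk
    have hidx : k.idx = (-(i : ℤ), s) := hval (add_right_cancel hk)
    have hlen := k.length_le_neg_idx
    rw [hidx, neg_neg, Nat.cast_le] at hlen
    exact ⟨_, (totalDegree_wordPoly_le α β i k.1.1 k.2).trans (by omega), h.describes_vec hidx⟩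
  | zero => exact ⟨0, by simp, .zero⟩
  | add _ _ _ _ hx hy =>
    obtain ⟨p, hp, hxp⟩ := hx
    obtain ⟨q, hq, hyq⟩ := hy
    exact ⟨p + q, (totalDegree_add p q).trans (max_le hp hq), hxp.add hyq⟩
  | smul a _ _ hx =>
    obtain ⟨p, hp, hxp⟩ := hx
    exact ⟨a • p, (totalDegree_smul_le a p).trans hp, hxp.smul a⟩

theorem describes_opr (h : IsTopLevel α β e π) {w : E} {q : MvPolynomial (Fin i) ℂ}
    (hq : Describes π s w q) (x : M₀) :
    Describes π (x + s) (opr E ((0, x) : Idx M₀) w) (polyOp (s + α + x * β) (x : ℂ) q) := by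
  intro c
  have hterm (j : Fin i) :
      (1 + ((List.ofFn c).getD j 0 : ℂ) - x) •
          π (levelOneWord E ((List.ofFn c).modify j (x + ·)) w) =
        ((1 + c j - x) * eval ((fun j => (c j : ℂ)) + Pi.single j (x : ℂ)) q) •
          v (x + s + ∑ j, c j) := by
    rw [hq.proj_modify, smul_smul]
    simp
  have hcomm := congrArg π (LinearMap.congr_fun (opr_mul_levelOneWord (E := E) x (List.ofFn c)) w)
  rw [Module.End.mul_apply, h.proj_opr rfl, hq c, map_smul, act_d, LinearMap.add_apply,
    LinearMap.sum_apply, map_add, map_sum, List.length_ofFn, Module.End.mul_apply,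
    ← Fin.sum_univ_eq_sum_range fun q => π (((1 + ((List.ofFn c).getD q 0 : ℂ) - x) •
      levelOneWord E ((List.ofFn c).modify q (x + ·))) w), ← sub_eq_iff_eq_add'] at hcomm
  simp only [LinearMap.smul_apply, map_smul, hterm] at hcomm
  rw [← hcomm, ← Finset.sum_smul, smul_smul, ← add_assoc x s, ← sub_smul, eval_polyOp,
    sub_eq_add_neg, ← Finset.sum_neg_distrib]
  congr 2
  · push_cast
    ring
  · exact Finset.sum_congr rfl fun j _ => by ring

theorem exists_polynomialMap [Infinite M₀] (h : IsTopLevel α β e π)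
    (hval : Function.Injective (val : Idx M₀ → ℂ)) (i : ℕ) (s : M₀) :
    ∃ Φ : weightSpace E α ((-i, s) : Idx M₀) →ₗ[ℂ] MvPolynomial (Fin i) ℂ,
      ∀ w, (Φ w).totalDegree ≤ 2 * i ∧ Describes π s w.1 (Φ w) := by
  choose f hdeg hf using fun w : weightSpace E α ((-i, s) : Idx M₀) =>
    h.exists_describes hval w.2
  exact ⟨{ toFun := f
           map_add' := fun x y => (hf (x + y)).unique ((hf x).add (hf y))
           map_smul' := fun a x => (hf (a • x)).unique ((hf x).smul a) },
    fun w => ⟨hdeg w, hf w⟩⟩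

theorem eq_zero_of_describes_zero (h : IsTopLevel α β e π) (hM₀ : M₀ ≠ ⊥)
    (hval : Function.Injective (val : Idx M₀ → ℂ))
    (hfaith : ∀ w, (∀ u : U M₀, π (u • w) = 0) → w = 0) {w : E}
    (hw : w ∈ weightSpace E α (-i, s)) (h0 : Describes π s w (0 : MvPolynomial (Fin i) ℂ)) :
    w = 0 := by
  rw [← Submodule.mem_bot ℂ, ← h.levelOneKer_eq_bot hM₀ hfaith, mem_levelOneKer]
  intro c
  by_cases hc : c.length = i
  · subst hc
    simpa using h0 c.get
  · exact h.proj_levelOneWord_eq_zero hval hw hc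

theorem rank_weightSpace_eq (h : IsTopLevel α β e π) (hM₀ : M₀ ≠ ⊥)
    (hval : Function.Injective (val : Idx M₀ → ℂ))
    (hfaith : ∀ w, (∀ u : U M₀, π (u • w) = 0) → w = 0) {a₁ a₂ : M₀}
    (h₁ : (a₁ : ℂ) + α - i ≠ 0) (h₂ : (a₂ : ℂ) + α - i ≠ 0) :
    Module.rank ℂ (weightSpace E α ((-i, a₁) : Idx M₀)) =
      Module.rank ℂ (weightSpace E α ((-i, a₂) : Idx M₀)) := by
  obtain ⟨x, hx⟩ := AddSubgroup.ne_bot_iff_exists_ne_zero.1 hM₀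
  have : Infinite M₀ := Set.infinite_univ_iff.1 <|
    ((infinite_range_add_nsmul_iff 0 x).2 hx).mono (Set.subset_univ _)
  choose Φ hΦ using h.exists_polynomialMap hval i
  have hinj (s : M₀) : Function.Injective (Φ s) := by
    refine (injective_iff_map_eq_zero (Φ s)).2 fun w hw => Subtype.ext ?_
    exact h.eq_zero_of_describes_zero hM₀ hval hfaith w.2 (hw ▸ (hΦ s w).2)
  have hpolyOp (x s : M₀) (p) (hp : p ∈ LinearMap.range (Φ s)) :
      polyOp (s + α + x * β) (x : ℂ) p ∈ LinearMap.range (Φ (x + s)) := by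
    obtain ⟨w, rfl⟩ := hp
    have hmem : opr E ((0, x) : Idx M₀) w.1 ∈ weightSpace E α ((-i, x + s) : Idx M₀) := by
      simpa using opr_mem_weightSpace (0, x) w.2
    exact ⟨⟨_, hmem⟩, (hΦ _ ⟨_, hmem⟩).2.unique (h.describes_opr (hΦ s w).2 x)⟩
  have hdeg (s : M₀) : LinearMap.range (Φ s) ≤ degreeLT (Fin i) ℂ (2 * i + 1) := by
    rintro _ ⟨w, rfl⟩
    exact mem_degreeLT_of_totalDegree_lt (Nat.lt_succ_of_le (hΦ s w).1)
  have hrank (s : M₀) := (LinearEquiv.ofInjective _ (hinj s)).lift_rank_eq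
  have hrange := rank_eq_of_polyOp hpolyOp hdeg (s := a₁) (t := a₂) (by simpa using h₁)
    (by simpa using h₂)
  exact Cardinal.lift_inj.1 ((hrank a₁).trans (hrange ▸ (hrank a₂).symm))

end IsTopLevel

end Polynomials

end GenVir

end

theorem corollary3p2 (M₀ : AddSubgroup ℂ) (hM₀ : M₀ ≠ ⊥)
    (hdisj : Disjoint (AddSubgroup.zmultiples (1 : ℂ)) M₀) (α β : ℂ) (i : ℕ) (a₁ a₂ : M₀)
    (h : (-(i : ℂ) + α + a₁) * (-(i : ℂ) + α + a₂) ≠ 0) :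
    Module.rank ℂ (GenVir.wt M₀ α β (-(i : ℂ) + α + a₁))
      = Module.rank ℂ (GenVir.wt M₀ α β (-(i : ℂ) + α + a₂)) := by
  have hval := GenVir.val_injective hdisj
  obtain ⟨e, π, htop, hfaith⟩ := GenVir.exists_isTopLevel_Vbar (α := α) (β := β) hval
  have hne {a : M₀} (ha : -(i : ℂ) + α + a ≠ 0) : (a : ℂ) + α - i ≠ 0 := by
    convert ha using 1
    ring
  rw [GenVir.wt_eq_weightSpace, GenVir.wt_eq_weightSpace]
  exact htop.rank_weightSpace_eq hM₀ hval hfaith (hne (left_ne_zero_of_mul h))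
    (hne (right_ne_zero_of_mul h))
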